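/- For an integer $b\ge 2$ and a nonempty set $E\subset\{0,\dots,b-1\}$ let $K(b,E)=\sum 1/m$, the sum being over the positive integers $m$ none of whose base-$b$ digits (without leading zeros) lies in $E$. Let $\mu_{b,E}=\sum_X b^{-|X|}\,\delta_{n(X)/b^{|X|}}$ be the discrete measure on $[0,1)$ where $X=(d_l,\dots,d_1)$ runs over all finite strings (including the empty one) of digits in $\{0,\dots,b-1\}\setminus E$, $|X|=l$ and $n(X)=\sum_{i=1}^{l} d_i b^{i-1}$. For $E=\{0\}$ put $u_m=u_m(b)=\int_{[0,1)}x^m\,\mu_{b,\{0\}}(dx)$. Then: (1) For every $b\ge2$ the series defining $K(b,\{0\})$ and $K(b,\{b-1\})$ converge, and as $b\to\infty$ through the integers $$K(b,\{0\})=b\log b+\frac{\zeta(2)}{2b}-\frac{\zeta(3)}{3b^2}+O(b^{-3}),$$ $$K(b,\{b-1\})=b\log b-\frac{\zeta(2)}{2b}-\frac{3\zeta(2)+\zeta(3)}{3b^2}+O(b^{-3}).$$ (2) Both admit full asymptotic expansions in descending powers of $b$ to all orders: there are real sequences $(a_k)_{k\ge1}$ and $(a'_k)_{k\ge1}$ such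 that for every $M\ge0$, as $b\to\infty$, $$K(b,\{0\})=b\log b+\sum_{k=1}^{M}\frac{a_k}{b^k}+O(b^{-M-1}),\qquad K(b,\{b-1\})=b\log b+\sum_{k=1}^{M}\frac{a'_k}{b^k}+O(b^{-M-1}).$$ (3) For every $b\ge2$, $$K(b,\{0\})=b\log b+\sum_{m=1}^{\infty}(-1)^{m-1}\frac{\zeta(m+1)u_m}{b^{m+1}},$$ and for every $n\ge0$ $$b\log b+\sum_{m=1}^{2n}(-1)^{m-1}\frac{\zeta(m+1)u_m}{b^{m+1}}<K(b,\{0\})<b\log b+\sum_{m=1}^{2n+1}(-1)^{m-1}\frac{\zeta(m+1)u_m}{b^{m+1}}.$$ In particular $$b\log b+\frac{\zeta(2)u_1}{b^2}-\frac{\zeta(3)u_2}{b^3}<K(b,\{0\})<b\log b+\frac{\zeta(2)u_1}{b^2}-\frac{\zeta(3)u_2}{b^3}+\frac{\zeta(4)u_3}{b^4},$$ where $$\frac{u_1}{b^2}=\frac1{2b}-\frac1{2b(b^2-b+1)},\qquad \frac{u_2}{b^3}=\frac1{3b^2}-\frac{5b^2-5b+2}{6b^2(b^2-b+1)(b^3-b+1)},\qquad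 0<u_3<\frac b4.$$ -/

import Mathlib

open MeasureTheory Filter Asymptotics
open scoped ENNReal

noncomputable section

/-- The positive integers none of whose base `b` digits (in the minimal representation, without
leading zeros) belongs to the set `E` of excluded digits. -/
def kempnerSet (b : ℕ) (E : Set ℕ) : Set ℕ :=
  {m : ℕ | 0 < m ∧ ∀ d ∈ Nat.digits b m, d ∉ E}

/-- The Kempner sum `K(b, E)`: the sum of `1 / m` over the positive integers `m` having no base `b`
digit in `E`. -/
def kempnerSum (b : ℕ) (E : Set ℕ) : ℝ :=
  ∑' m : kempnerSet b E, 1 / ((m : ℕ) : ℝ)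

/-- The admissible strings: finite strings (the empty one included) of digits in
`{0, …, b - 1} \ E`. A string is stored with its least significant digit first, leading zeros
being allowed, so that `Nat.ofDigits b X` is the integer `n(X)` it denotes. -/
def AdmissibleString (b : ℕ) (E : Set ℕ) : Type :=
  {X : List ℕ // ∀ d ∈ X, d < b ∧ d ∉ E}

/-- The discrete measure `μ_{b,E}`: each admissible string `X` of length `|X|` contributes the mass
`b ^ (-|X|)` at the point `n(X) / b ^ |X|` of `[0, 1)`. -/
def kempnerMeasure (b : ℕ) (E : Set ℕ) : Measure ℝ :=
  Measure.sum fun X : AdmissibleString b E =>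
    ((b : ℝ≥0∞)⁻¹ ^ X.1.length) •
      Measure.dirac ((Nat.ofDigits b X.1 : ℝ) / (b : ℝ) ^ X.1.length)

/-- The moment `u_m = ∫_{[0,1)} x ^ m μ_{b,E}(dx)`. -/
def kempnerMoment (b : ℕ) (E : Set ℕ) (m : ℕ) : ℝ :=
  ∫ x in Set.Ico (0 : ℝ) 1, x ^ m ∂(kempnerMeasure b E)

/-- The real number `ζ(n)`, used for integers `n ≥ 2`. -/
def zetaValue (n : ℕ) : ℝ := (riemannZeta (n : ℂ)).re

/-- `f(b)` has the asymptotic expansion `∑_{k ≥ 1} a_k b ^ (-k)` to all orders, as the integer `b`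
tends to infinity. -/
def HasFullExpansion (f : ℕ → ℝ) (a : ℕ → ℝ) : Prop :=
  ∀ M : ℕ, (fun b : ℕ => f b - ∑ k ∈ Finset.Icc 1 M, a k / (b : ℝ) ^ k)
    =O[atTop] fun b : ℕ => 1 / (b : ℝ) ^ (M + 1)

end

/-! Write H(s) = ψ(1 + s) + γ (`harmonicExt`). Splitting m into its leading digit h and the string X
of the other digits gives 1/m = b^(-|X|) / (h + x) with x = n(X)/b^|X|, so K(b, E) is the sum over
leading digits h of ∫ 1/(h + x) dμ (`kempner_hasSum`). Gauss's formula `harmonicExt_multiplication`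
expresses the sum of b/(d + x) over 0 < d < b as b log b - b H(x) plus the sum of H((d + x)/b) over
0 ≤ d < b. The measure is self-similar (`ifsMean_eq`), so on integration the H((d + x)/b) with d
admissible cancel b H(x), up to the atom at the starting point, where the function vanishes. Only
the excluded digit survives: K = b log b + (1/b) ∫ H(±y/b), the sign being + for E = {0} and, after
the reflection y = 1 - x, - for E = {b - 1}.

Expanding H at 0, where its Taylor coefficients are ±ζ(m + 2), gives a series in the moments of
total size O(b^(-m-1)) per term (`ifsMean_harmonicExt_hasSum`). The recurrence
`ifsMoment_recurrence` makes each moment divided by b analytic in 1/b, whence the full expansions;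
for E = {0} the series alternates with strictly decreasing terms, whence the bounds. -/

/-! ### Self-similar means and their moments. -/

/-- The point of `[0, 1]` reached from `ε` by the maps `y ↦ (a + 1 + y) / b`, `a < b - 1`, the head
of the list being applied last. -/
noncomputable def ifsPoint (b : ℕ) (ε : ℝ) : List (Fin (b - 1)) → ℝ
  | [] => ε
  | a :: X => ((a : ℝ) + 1 + ifsPoint b ε X) / b

/-- The integral of `f` against the measure `∑_X b ^ (-|X|) δ_{ifsPoint b ε X}`. -/
noncomputable def ifsMean (b : ℕ) (ε : ℝ) (f : ℝ → ℝ) : ℝ :=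
  ∑' X : List (Fin (b - 1)), f (ifsPoint b ε X) / (b : ℝ) ^ X.length

/-- The moments of the measure behind `ifsMean`. -/
noncomputable def ifsMoment (b : ℕ) (ε : ℝ) (m : ℕ) : ℝ := ifsMean b ε (fun y => y ^ m)

lemma cast_fin_pred_le {b : ℕ} (hb : 2 ≤ b) (a : Fin (b - 1)) : (a : ℝ) + 1 ≤ b - 1 := by
  have h : (a : ℕ) + 2 ≤ b := by have := a.2; omega
  have h' : ((a : ℕ) : ℝ) + 2 ≤ b := by exact_mod_cast h
  linarith

lemma ifsPoint_mem {b : ℕ} (hb : 2 ≤ b) {ε : ℝ} (hε : ε ∈ Set.Icc (0 : ℝ) 1)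
    (X : List (Fin (b - 1))) : ifsPoint b ε X ∈ Set.Icc (0 : ℝ) 1 := by
  induction X with
  | nil => exact hε
  | cons a X ih =>
    have hb0 : (0 : ℝ) < b := by positivity
    have ha := cast_fin_pred_le hb a
    obtain ⟨h0, h1⟩ := ih
    refine ⟨?_, ?_⟩
    · simp only [ifsPoint]; positivity
    · simp only [ifsPoint]
      rw [div_le_one hb0]; linarith

/-- There are (b - 1)^l lists of length l, so grouping by length gives a geometric series of ratio
(b - 1)/b. -/
lemma summable_list_weight {b : ℕ} (hb : 2 ≤ b) :
    Summable (fun X : List (Fin (b - 1)) => 1 / (b : ℝ) ^ X.length) := by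
  rw [← (List.equivSigmaTuple (α := Fin (b - 1))).symm.summable_iff,
    summable_sigma_of_nonneg (fun _ => by simp only [Function.comp]; positivity)]
  refine ⟨fun _ => (hasSum_fintype _).summable, ?_⟩
  have hb0 : (0 : ℝ) < b := by positivity
  have hlt : (((b - 1 : ℕ) : ℝ) / b) < 1 := by
    rw [div_lt_one hb0]; exact_mod_cast Nat.sub_lt (by omega) one_pos
  refine (summable_geometric_of_lt_one (by positivity) hlt).congr fun l => ?_
  rw [tsum_fintype]
  simp [List.equivSigmaTuple, mul_pow, div_eq_mul_inv]

lemma summable_ifsMean {b : ℕ} (hb : 2 ≤ b) {ε : ℝ} (hε : ε ∈ Set.Icc (0 : ℝ) 1) {f : ℝ → ℝ}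
    {C : ℝ} (hf : ∀ y ∈ Set.Icc (0 : ℝ) 1, |f y| ≤ C) :
    Summable (fun X : List (Fin (b - 1)) => f (ifsPoint b ε X) / (b : ℝ) ^ X.length) := by
  refine Summable.of_norm_bounded ((summable_list_weight hb).mul_left C) fun X => ?_
  rw [Real.norm_eq_abs, abs_div, abs_of_pos (a := (b : ℝ) ^ X.length) (by positivity), mul_one_div]
  gcongr
  exact hf _ (ifsPoint_mem hb hε X)

/-- A list is empty or has a head and a tail. -/
def sumProdEquivList (α : Type*) : Unit ⊕ α × List α ≃ List α where
  toFun := Sum.elim (fun _ => []) (fun p => p.1 :: p.2)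
  invFun
    | [] => Sum.inl ()
    | a :: X => Sum.inr (a, X)
  left_inv := by rintro (_ | _) <;> rfl
  right_inv := by rintro (_ | _) <;> rfl

lemma tsum_list {α : Type*} [Fintype α] {F : List α → ℝ} (hF : Summable F) :
    ∑' X, F X = F [] + ∑ a : α, ∑' X, F (a :: X) := by
  have hr : Summable (fun p : α × List α => F (p.1 :: p.2)) :=
    ((sumProdEquivList α).summable_iff.mpr hF).comp_injective Sum.inr_injective
  have hu : HasSum (fun _ : Unit => F []) (F []) := hasSum_unique _
  have hp := hr.hasSum
  rw [hr.tsum_prod, tsum_fintype] at hp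
  have key : HasSum (F ∘ sumProdEquivList α) (F [] + ∑ a : α, ∑' X, F (a :: X)) :=
    HasSum.sum hu hp
  exact ((sumProdEquivList α).hasSum_iff.mp key).tsum_eq

/-- The measure behind `ifsMean` is invariant up to the mass at `ε`. -/
lemma ifsMean_eq {b : ℕ} (hb : 2 ≤ b) {ε : ℝ} (hε : ε ∈ Set.Icc (0 : ℝ) 1) {f : ℝ → ℝ}
    {C : ℝ} (hf : ∀ y ∈ Set.Icc (0 : ℝ) 1, |f y| ≤ C) :
    ifsMean b ε f =
      f ε + (∑ a : Fin (b - 1), ifsMean b ε (fun y => f (((a : ℝ) + 1 + y) / b))) / b := by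
  rw [ifsMean, tsum_list (summable_ifsMean hb hε hf), Finset.sum_div]
  congr 1
  · simp [ifsPoint]
  · refine Finset.sum_congr rfl fun a _ => ?_
    rw [ifsMean, ← tsum_div_const]
    refine tsum_congr fun X => ?_
    rw [List.length_cons, pow_succ, div_div, ifsPoint]

lemma ifsMean_add {b : ℕ} (hb : 2 ≤ b) {ε : ℝ} (hε : ε ∈ Set.Icc (0 : ℝ) 1) {f g : ℝ → ℝ}
    {C D : ℝ} (hf : ∀ y ∈ Set.Icc (0 : ℝ) 1, |f y| ≤ C) (hg : ∀ y ∈ Set.Icc (0 : ℝ) 1, |g y| ≤ D) :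
    ifsMean b ε (fun y => f y + g y) = ifsMean b ε f + ifsMean b ε g := by
  unfold ifsMean
  rw [← (summable_ifsMean hb hε hf).tsum_add (summable_ifsMean hb hε hg)]
  simp_rw [add_div]

lemma ifsMean_sum {b : ℕ} (hb : 2 ≤ b) {ε : ℝ} (hε : ε ∈ Set.Icc (0 : ℝ) 1) {ι : Type*}
    (s : Finset ι) {f : ι → ℝ → ℝ} {C : ι → ℝ}
    (hf : ∀ i ∈ s, ∀ y ∈ Set.Icc (0 : ℝ) 1, |f i y| ≤ C i) :
    ifsMean b ε (fun y => ∑ i ∈ s, f i y) = ∑ i ∈ s, ifsMean b ε (f i) := by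
  unfold ifsMean
  rw [← Summable.tsum_finsetSum (fun i hi => summable_ifsMean hb hε (hf i hi))]
  simp_rw [Finset.sum_div]

lemma ifsMean_const_mul (b : ℕ) (ε c : ℝ) (f : ℝ → ℝ) :
    ifsMean b ε (fun y => c * f y) = c * ifsMean b ε f := by
  unfold ifsMean
  rw [← tsum_mul_left]
  simp_rw [mul_div_assoc]

lemma ifsMean_congr {b : ℕ} (hb : 2 ≤ b) {ε : ℝ} (hε : ε ∈ Set.Icc (0 : ℝ) 1) {f g : ℝ → ℝ}
    (h : ∀ y ∈ Set.Icc (0 : ℝ) 1, f y = g y) : ifsMean b ε f = ifsMean b ε g := by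
  unfold ifsMean
  exact tsum_congr fun X => by rw [h _ (ifsPoint_mem hb hε X)]

lemma ifsMean_mono {b : ℕ} (hb : 2 ≤ b) {ε : ℝ} (hε : ε ∈ Set.Icc (0 : ℝ) 1) {f g : ℝ → ℝ}
    {C D : ℝ} (hf : ∀ y ∈ Set.Icc (0 : ℝ) 1, |f y| ≤ C) (hg : ∀ y ∈ Set.Icc (0 : ℝ) 1, |g y| ≤ D)
    (h : ∀ y ∈ Set.Icc (0 : ℝ) 1, f y ≤ g y) : ifsMean b ε f ≤ ifsMean b ε g := by
  unfold ifsMean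
  refine (summable_ifsMean hb hε hf).tsum_le_tsum (fun X => ?_) (summable_ifsMean hb hε hg)
  gcongr
  exact h _ (ifsPoint_mem hb hε X)

lemma abs_pow_le_one_of_mem_Icc {y : ℝ} (hy : y ∈ Set.Icc (0 : ℝ) 1) (m : ℕ) : |y ^ m| ≤ 1 := by
  rw [abs_of_nonneg (pow_nonneg hy.1 m)]
  exact pow_le_one₀ hy.1 hy.2

/-- Self-similarity gives T = 1 + (b - 1) T / b for the total mass T, hence T = b. -/
lemma ifsMean_const {b : ℕ} (hb : 2 ≤ b) {ε : ℝ} (hε : ε ∈ Set.Icc (0 : ℝ) 1) (c : ℝ) :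
    ifsMean b ε (fun _ => c) = c * b := by
  have h := ifsMean_eq hb hε (f := fun _ => c) (C := |c|) (fun _ _ => le_rfl)
  have hb0 : (0 : ℝ) < b := by positivity
  have hc : ((b - 1 : ℕ) : ℝ) = b - 1 := by rw [Nat.cast_sub (by omega)]; simp
  rw [Finset.sum_const, Finset.card_univ, Fintype.card_fin, nsmul_eq_mul, hc] at h
  field_simp at h
  linarith

lemma ifsMoment_zero {b : ℕ} (hb : 2 ≤ b) {ε : ℝ} (hε : ε ∈ Set.Icc (0 : ℝ) 1) :
    ifsMoment b ε 0 = b := by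
  simpa [ifsMoment] using ifsMean_const hb hε 1

lemma ifsMoment_nonneg {b : ℕ} (hb : 2 ≤ b) {ε : ℝ} (hε : ε ∈ Set.Icc (0 : ℝ) 1) (m : ℕ) :
    0 ≤ ifsMoment b ε m :=
  tsum_nonneg fun X => div_nonneg (pow_nonneg (ifsPoint_mem hb hε X).1 m) (by positivity)

lemma ifsMoment_succ_le {b : ℕ} (hb : 2 ≤ b) {ε : ℝ} (hε : ε ∈ Set.Icc (0 : ℝ) 1) (m : ℕ) :
    ifsMoment b ε (m + 1) ≤ ifsMoment b ε m :=
  ifsMean_mono hb hε (fun _ hy => abs_pow_le_one_of_mem_Icc hy _)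
    (fun _ hy => abs_pow_le_one_of_mem_Icc hy _)
    (fun _ hy => pow_le_pow_of_le_one hy.1 hy.2 m.le_succ)

lemma ifsMoment_le {b : ℕ} (hb : 2 ≤ b) {ε : ℝ} (hε : ε ∈ Set.Icc (0 : ℝ) 1) (m : ℕ) :
    ifsMoment b ε m ≤ b := by
  rw [← ifsMoment_zero hb hε]
  exact antitone_nat_of_succ_le (ifsMoment_succ_le hb hε) m.zero_le

lemma ifsMoment_pos {b : ℕ} (hb : 2 ≤ b) {ε : ℝ} (hε : ε ∈ Set.Icc (0 : ℝ) 1) (m : ℕ) :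
    0 < ifsMoment b ε m := by
  have hb0 : (0 : ℝ) < b := by positivity
  refine (summable_ifsMean hb hε (f := fun y => y ^ m)
    (fun _ hy => abs_pow_le_one_of_mem_Icc hy _)).tsum_pos
    (fun X => div_nonneg (pow_nonneg (ifsPoint_mem hb hε X).1 m) (by positivity))
    -- The empty list may contribute 0 when `ε = 0`; the one-letter list has the positive point (1 +
    -- ε)/b.
    [⟨0, by omega⟩] ?_
  have := hε.1
  simp only [ifsPoint]
  positivity

/-- The linear recurrence for the moments. -/
lemma ifsMoment_recurrence {b : ℕ} (hb : 2 ≤ b) {ε : ℝ} (hε : ε ∈ Set.Icc (0 : ℝ) 1) (m : ℕ) :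
    ((b : ℝ) ^ (m + 1) - b + 1) * ifsMoment b ε m = ε ^ m * (b : ℝ) ^ (m + 1) +
      ∑ j ∈ Finset.range m,
        (m.choose j : ℝ) * (∑ a : Fin (b - 1), ((a : ℝ) + 1) ^ (m - j)) * ifsMoment b ε j := by
  have hb0 : (0 : ℝ) < b := by positivity
  have hc : ((b - 1 : ℕ) : ℝ) = b - 1 := by rw [Nat.cast_sub (by omega)]; simp
  have h1 (a : Fin (b - 1)) : ifsMean b ε (fun y => (((a : ℝ) + 1 + y) / b) ^ m) =
      (∑ j ∈ Finset.range (m + 1),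
        (m.choose j : ℝ) * ((a : ℝ) + 1) ^ (m - j) * ifsMoment b ε j) / (b : ℝ) ^ m := by
    have : (fun y : ℝ => (((a : ℝ) + 1 + y) / b) ^ m) = fun y => ∑ j ∈ Finset.range (m + 1),
        ((m.choose j : ℝ) * ((a : ℝ) + 1) ^ (m - j) / (b : ℝ) ^ m) * y ^ j := by
      funext y
      rw [div_pow, add_comm, add_pow, Finset.sum_div]
      exact Finset.sum_congr rfl fun j _ => by ring
    rw [this, ifsMean_sum hb hε (Finset.range (m + 1)) (f := fun j y =>
      ((m.choose j : ℝ) * ((a : ℝ) + 1) ^ (m - j) / (b : ℝ) ^ m) * y ^ j) (C := fun j =>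
      |(m.choose j : ℝ) * ((a : ℝ) + 1) ^ (m - j) / (b : ℝ) ^ m|), Finset.sum_div]
    · refine Finset.sum_congr rfl fun j _ => ?_
      rw [ifsMean_const_mul, ifsMoment]
      ring
    · intro j _ y hy
      rw [abs_mul]
      exact mul_le_of_le_one_right (abs_nonneg _) (abs_pow_le_one_of_mem_Icc hy j)
  have h := ifsMean_eq hb hε (f := fun y => y ^ m) (fun _ hy => abs_pow_le_one_of_mem_Icc hy m)
  simp_rw [h1] at h
  -- The term j = m is b - 1 times the unknown moment itself; moved to the left it produces the
  -- factor b^(m+1) - b + 1.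
  rw [← Finset.sum_div, Finset.sum_comm, Finset.sum_range_succ] at h
  change ifsMoment b ε m = _ at h
  simp only [Nat.choose_self, Nat.sub_self, pow_zero, Nat.cast_one, one_mul, Finset.sum_const,
    Finset.card_univ, Fintype.card_fin, nsmul_eq_mul, hc] at h
  simp_rw [← Finset.sum_mul, ← Finset.mul_sum] at h
  field_simp at h
  rw [pow_succ]
  linarith

/-! ### The harmonic number function and integer zeta values. -/

/-- The harmonic number function `s ↦ ψ (1 + s) + γ`. -/
noncomputable def harmonicExt (s : ℝ) : ℝ := ∑' n : ℕ, (1 / ((n : ℝ) + 1) - 1 / ((n : ℝ) + 1 + s))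

lemma summable_one_div_nat_add_one_pow {k : ℕ} (hk : 2 ≤ k) :
    Summable (fun n : ℕ => 1 / ((n : ℝ) + 1) ^ k) := by
  have := (summable_nat_add_iff 1).mpr (Real.summable_one_div_nat_pow.mpr (show 1 < k by omega))
  simpa using this

lemma zetaValue_eq_tsum {k : ℕ} (hk : 2 ≤ k) :
    zetaValue k = ∑' n : ℕ, 1 / ((n : ℝ) + 1) ^ k := by
  have h1 : riemannZeta k = ((∑' n : ℕ, 1 / (n : ℝ) ^ k : ℝ) : ℂ) := by
    rw [zeta_nat_eq_tsum_of_gt_one (by omega)]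
    push_cast
    rfl
  rw [zetaValue, h1, Complex.ofReal_re,
    (Real.summable_one_div_nat_pow.mpr (show 1 < k by omega)).tsum_eq_zero_add]
  simp [show k ≠ 0 by omega]

lemma zetaValue_pos {k : ℕ} (hk : 2 ≤ k) : 0 < zetaValue k := by
  rw [zetaValue_eq_tsum hk]
  exact (summable_one_div_nat_add_one_pow hk).tsum_pos (fun _ => by positivity) 0 (by simp)

lemma zetaValue_succ_le {k : ℕ} (hk : 2 ≤ k) : zetaValue (k + 1) ≤ zetaValue k := by
  rw [zetaValue_eq_tsum hk, zetaValue_eq_tsum (by omega)]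
  refine (summable_one_div_nat_add_one_pow (by omega)).tsum_le_tsum (fun n => ?_)
    (summable_one_div_nat_add_one_pow hk)
  refine one_div_le_one_div_of_le (by positivity) (pow_le_pow_right₀ ?_ k.le_succ)
  linarith [(Nat.cast_nonneg n : (0 : ℝ) ≤ n)]

lemma zetaValue_le_two {k : ℕ} (hk : 2 ≤ k) : zetaValue k ≤ 2 := by
  induction k, hk using Nat.le_induction with
  | base =>
    have h : zetaValue 2 = Real.pi ^ 2 / 6 := by
      have := riemannZeta_two
      rw [zetaValue, Nat.cast_ofNat, this]
      norm_cast
    rw [h]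
    nlinarith [Real.pi_lt_d2, Real.pi_pos]
  | succ k hk ih => exact (zetaValue_succ_le hk).trans ih

/-- The range s ≥ -1/2 keeps n + 1 + s ≥ (n + 1)/2, and it contains every -y/b with y ≤ 1 and b ≥ 2.
-/
lemma abs_harmonicExt_term_le {s : ℝ} (hs : -(1 / 2) ≤ s) (n : ℕ) :
    |1 / ((n : ℝ) + 1) - 1 / ((n : ℝ) + 1 + s)| ≤ 2 * |s| * (1 / ((n : ℝ) + 1) ^ 2) := by
  have hn : (0 : ℝ) < (n : ℝ) + 1 := by positivity
  have hn' : (1 : ℝ) ≤ (n : ℝ) + 1 := by linarith [(Nat.cast_nonneg n : (0 : ℝ) ≤ n)]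
  have hns : ((n : ℝ) + 1) / 2 ≤ (n : ℝ) + 1 + s := by linarith
  have hpos : 0 < (n : ℝ) + 1 + s := by linarith
  have : 1 / ((n : ℝ) + 1) - 1 / ((n : ℝ) + 1 + s) =
      s / (((n : ℝ) + 1) * ((n : ℝ) + 1 + s)) := by
    field_simp; ring
  rw [this, abs_div, abs_of_pos (mul_pos hn hpos), mul_one_div, div_le_div_iff₀ (by positivity)
    (by positivity)]
  have : ((n : ℝ) + 1) ^ 2 ≤ 2 * (((n : ℝ) + 1) * ((n : ℝ) + 1 + s)) := by nlinarith
  nlinarith [abs_nonneg s]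

lemma summable_harmonicExt {s : ℝ} (hs : -(1 / 2) ≤ s) :
    Summable (fun n : ℕ => 1 / ((n : ℝ) + 1) - 1 / ((n : ℝ) + 1 + s)) :=
  Summable.of_norm_bounded ((summable_one_div_nat_add_one_pow le_rfl).mul_left (2 * |s|))
    (abs_harmonicExt_term_le hs)

lemma abs_harmonicExt_le {s : ℝ} (hs : -(1 / 2) ≤ s) : |harmonicExt s| ≤ 4 * |s| := by
  have h := tsum_of_norm_bounded
    ((summable_one_div_nat_add_one_pow le_rfl).mul_left (2 * |s|)).hasSum
    (fun n => (Real.norm_eq_abs _).trans_le (abs_harmonicExt_term_le hs n))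
  rw [tsum_mul_left, ← zetaValue_eq_tsum le_rfl, Real.norm_eq_abs] at h
  refine h.trans ?_
  nlinarith [zetaValue_le_two (le_refl 2), abs_nonneg s]

lemma harmonicExt_zero : harmonicExt 0 = 0 := by simp [harmonicExt]

/-- The partial sums telescope up to 1/(n + s), which tends to 0. This shift absorbs the missing
leading digit b - 1. -/
lemma harmonicExt_sub_one {s : ℝ} (hs : 1 / 2 ≤ s) :
    harmonicExt (s - 1) = harmonicExt s - 1 / s := by
  have h1 := (summable_harmonicExt (s := s) (by linarith)).hasSum.tendsto_sum_nat
  have h2 := (summable_harmonicExt (s := s - 1) (by linarith)).hasSum.tendsto_sum_nat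
  have h3 : Tendsto (fun n : ℕ => 1 / ((n : ℝ) + s)) atTop (nhds 0) := by
    simp_rw [one_div]
    exact tendsto_inv_atTop_zero.comp
      (tendsto_atTop_add_const_right _ _ tendsto_natCast_atTop_atTop)
  have h4 : ∀ n : ℕ, ∑ i ∈ Finset.range n, (1 / ((i : ℝ) + 1) - 1 / ((i : ℝ) + 1 + (s - 1))) =
      ∑ i ∈ Finset.range n, (1 / ((i : ℝ) + 1) - 1 / ((i : ℝ) + 1 + s)) - 1 / s
        + 1 / ((n : ℝ) + s) := by
    intro n
    induction n with
    | zero => simp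
    | succ n ih =>
      rw [Finset.sum_range_succ, Finset.sum_range_succ, ih]
      have e1 : (n : ℝ) + 1 + (s - 1) = n + s := by ring
      push_cast
      rw [e1]
      ring
  have h5 := (h1.sub_const (1 / s)).add h3
  rw [add_zero] at h5
  refine tendsto_nhds_unique h2 (h5.congr fun n => (h4 n).symm)

lemma sum_range_mul_eq (b N : ℕ) (F : ℕ → ℝ) :
    ∑ k ∈ Finset.range (b * N), F k =
      ∑ d ∈ Finset.range b, ∑ n ∈ Finset.range N, F (b * n + d) := by
  induction N with
  | zero => simp
  | succ N ih =>
    rw [Nat.mul_succ, Finset.sum_range_add, ih, ← Finset.sum_add_distrib]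
    exact Finset.sum_congr rfl fun d _ => by rw [Finset.sum_range_succ]

/-- Gauss's multiplication formula for the digamma function. -/
lemma harmonicExt_multiplication {b : ℕ} (hb : 1 ≤ b) {x : ℝ} (hx : 0 ≤ x) :
    (∑ d ∈ Finset.range b, harmonicExt (((d : ℝ) + x) / b)) / b =
      harmonicExt x - Real.log b + ∑ d ∈ Finset.range (b - 1), 1 / ((d : ℝ) + 1 + x) := by
  have hb0 : (0 : ℝ) < b := by positivity
  have hd (d : ℕ) : -(1 / 2) ≤ ((d : ℝ) + x) / b := by
    have : 0 ≤ ((d : ℝ) + x) / b := by positivity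
    linarith
  have hL : Tendsto (fun N : ℕ => (∑ d ∈ Finset.range b, ∑ n ∈ Finset.range N,
      (1 / ((n : ℝ) + 1) - 1 / ((n : ℝ) + 1 + ((d : ℝ) + x) / b))) / b) atTop
      (nhds ((∑ d ∈ Finset.range b, harmonicExt (((d : ℝ) + x) / b)) / b)) :=
    (tendsto_finsetSum _ fun d _ => (summable_harmonicExt (hd d)).hasSum.tendsto_sum_nat).div_const _
  -- Cutting the right-hand series at bN + b - 1 makes the logarithm in the Euler–Mascheroni
  -- sequence log(b(N + 1)), so its difference from the one at N leaves exactly log b.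
  have hM : Tendsto (fun N : ℕ => b * N + (b - 1)) atTop atTop :=
    tendsto_atTop_mono (fun N => (Nat.le_mul_of_pos_left N hb).trans (Nat.le_add_right _ _))
      tendsto_id
  have hγ := Real.tendsto_eulerMascheroniSeq
  have hφ := (summable_harmonicExt (s := x) (by linarith)).hasSum.tendsto_sum_nat
  have hR := ((((hγ.sub (hγ.comp hM)).sub_const (Real.log b)).add (hφ.comp hM)).add_const
    (∑ d ∈ Finset.range (b - 1), 1 / ((d : ℝ) + 1 + x)))
  have e : harmonicExt x - Real.log b + ∑ d ∈ Finset.range (b - 1), 1 / ((d : ℝ) + 1 + x) =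
    Real.eulerMascheroniConstant - Real.eulerMascheroniConstant - Real.log b + harmonicExt x +
      ∑ d ∈ Finset.range (b - 1), 1 / ((d : ℝ) + 1 + x) := by ring
  rw [e]
  refine tendsto_nhds_unique hL (hR.congr fun N => ?_)
  have hlog : Real.log (((b * N + (b - 1) : ℕ) : ℝ) + 1) = Real.log b + Real.log ((N : ℝ) + 1) := by
    rw [← Real.log_mul (by positivity) (by positivity)]
    congr 1
    have : b * N + (b - 1) + 1 = b * (N + 1) := by rw [mul_add]; omega
    exact_mod_cast this
  have hH (n : ℕ) : ((harmonic n : ℚ) : ℝ) = ∑ i ∈ Finset.range n, 1 / ((i : ℝ) + 1) := by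
    simp [harmonic]
  -- The first b - 1 terms form the finite sum of the statement; the remaining bN split into residue
  -- classes modulo b.
  have hshift : ∑ k ∈ Finset.range (b * N + (b - 1)), 1 / ((k : ℝ) + 1 + x) =
      ∑ d ∈ Finset.range (b - 1), 1 / ((d : ℝ) + 1 + x) +
        ∑ d ∈ Finset.range b, ∑ n ∈ Finset.range N, 1 / ((b : ℝ) * (n + 1) + d + x) := by
    rw [add_comm (b * N), Finset.sum_range_add, sum_range_mul_eq]
    congr 1
    refine Finset.sum_congr rfl fun d _ => Finset.sum_congr rfl fun n _ => ?_
    have : (b - 1) + (b * n + d) + 1 = b * (n + 1) + d := by rw [mul_add]; omega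
    have h' : (((b - 1) + (b * n + d) : ℕ) : ℝ) + 1 = (b : ℝ) * (n + 1) + d := by
      exact_mod_cast this
    rw [h']
  have hdiv (d n : ℕ) : 1 / ((n : ℝ) + 1 + ((d : ℝ) + x) / b) =
      b * (1 / ((b : ℝ) * (n + 1) + d + x)) := by
    have : (b : ℝ) * (n + 1) + d + x ≠ 0 := by positivity
    have : (n : ℝ) + 1 + ((d : ℝ) + x) / b ≠ 0 := by positivity
    field_simp
    ring
  simp only [Function.comp, Real.eulerMascheroniSeq, hlog, hH, Finset.sum_sub_distrib, hshift, hdiv,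
    ← Finset.mul_sum, Finset.sum_const, Finset.card_range, nsmul_eq_mul]
  field_simp
  ring

/-- The Taylor expansion of the harmonic number function at `0`. -/
lemma harmonicExt_hasSum {s : ℝ} (hs : |s| ≤ 1 / 2) :
    HasSum (fun m : ℕ => (-1 : ℝ) ^ m * zetaValue (m + 2) * s ^ (m + 1)) (harmonicExt s) := by
  have hgeo : Summable (fun m : ℕ => (1 / 2 : ℝ) ^ (m + 1)) := by
    simp_rw [pow_succ]
    exact (summable_geometric_of_lt_one (by norm_num) (by norm_num)).mul_right _
  -- Each 1/(n + 1) - 1/(n + 1 + s) is a geometric series in -s/(n + 1). The double series is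
  -- dominated by (n + 1)^(-2) 2^(-m-1), so the order of summation may be exchanged, and summing
  -- over n first yields the zeta values.
  have hsum : Summable (fun p : ℕ × ℕ =>
      (-1 : ℝ) ^ p.2 * s ^ (p.2 + 1) * (1 / ((p.1 : ℝ) + 1) ^ (p.2 + 2))) := by
    refine Summable.of_norm_bounded ((summable_one_div_nat_add_one_pow le_rfl).mul_of_nonneg hgeo
      (fun _ => by positivity) (fun _ => by positivity)) fun p => ?_
    have hp : (1 : ℝ) ≤ (p.1 : ℝ) + 1 := by linarith [(Nat.cast_nonneg p.1 : (0 : ℝ) ≤ p.1)]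
    rw [norm_mul, norm_mul, norm_pow, norm_neg, norm_one, one_pow, one_mul, mul_comm, norm_pow,
      Real.norm_eq_abs, Real.norm_eq_abs, abs_of_pos (a := 1 / ((p.1 : ℝ) + 1) ^ (p.2 + 2))
        (by positivity)]
    gcongr
    · omega
  have hrow (n : ℕ) : HasSum (fun m : ℕ =>
      (-1 : ℝ) ^ m * s ^ (m + 1) * (1 / ((n : ℝ) + 1) ^ (m + 2)))
      (1 / ((n : ℝ) + 1) - 1 / ((n : ℝ) + 1 + s)) := by
    have hn : (0 : ℝ) < (n : ℝ) + 1 := by positivity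
    have hn1 : (1 : ℝ) ≤ (n : ℝ) + 1 := by linarith [(Nat.cast_nonneg n : (0 : ℝ) ≤ n)]
    have hpos : (n : ℝ) + 1 + s ≠ 0 := by
      have := neg_abs_le s
      linarith
    have hr : |-(s / ((n : ℝ) + 1))| < 1 := by
      rw [abs_neg, abs_div, abs_of_pos hn, div_lt_one hn]; linarith
    have h := (hasSum_geometric_of_abs_lt_one hr).mul_left (s / ((n : ℝ) + 1) ^ 2)
    have e : s / ((n : ℝ) + 1) ^ 2 * (1 - -(s / ((n : ℝ) + 1)))⁻¹ =
        1 / ((n : ℝ) + 1) - 1 / ((n : ℝ) + 1 + s) := by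
      have : 1 - -(s / ((n : ℝ) + 1)) = ((n : ℝ) + 1 + s) / ((n : ℝ) + 1) := by
        field_simp; ring
      rw [this]
      field_simp
      ring
    rw [e] at h
    refine h.congr_fun fun m => ?_
    rw [neg_pow (s / _), div_pow]
    field_simp
    ring
  have h1 : harmonicExt s = ∑' p : ℕ × ℕ,
      (-1 : ℝ) ^ p.2 * s ^ (p.2 + 1) * (1 / ((p.1 : ℝ) + 1) ^ (p.2 + 2)) := by
    rw [hsum.tsum_prod]
    exact tsum_congr fun n => (hrow n).tsum_eq.symm
  have hswap := hsum.prod_symm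
  have h2 := hswap.hasSum.prod_fiberwise fun m => (hswap.prod_factor m).hasSum
  rw [h1, ← (Equiv.prodComm ℕ ℕ).tsum_eq]
  refine h2.congr_fun fun m => ?_
  simp only [Prod.swap]
  rw [tsum_mul_left, zetaValue_eq_tsum (by omega)]
  ring

/-! ### Digit strings, the Kempner sum and the Kempner measure. -/

section Strings

variable {b : ℕ} {E : Set ℕ} {g : Fin (b - 1) → ℕ}

/-- The admissible string with most significant digit first spelled by `X`. -/
def spell (g : Fin (b - 1) → ℕ) (X : List (Fin (b - 1))) : List ℕ := (X.map g).reverse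

@[simp] lemma length_spell (X : List (Fin (b - 1))) : (spell g X).length = X.length := by
  simp [spell]

lemma spell_cons (a : Fin (b - 1)) (X : List (Fin (b - 1))) :
    spell g (a :: X) = spell g X ++ [g a] := by simp [spell]

lemma spell_injective (hg : Function.Injective g) : Function.Injective (spell g) :=
  List.reverse_injective.comp (List.map_injective_iff.mpr hg)

lemma spell_admissible (hr : Set.range g = {d | d < b ∧ d ∉ E}) (X : List (Fin (b - 1))) :
    ∀ d ∈ spell g X, d < b ∧ d ∉ E := by
  intro d hd
  obtain ⟨a, -, rfl⟩ : ∃ a ∈ X, g a = d := by simpa [spell] using hd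
  exact hr.subset ⟨a, rfl⟩

lemma exists_spell_eq (hr : Set.range g = {d | d < b ∧ d ∉ E}) {Y : List ℕ}
    (hY : ∀ d ∈ Y, d < b ∧ d ∉ E) : ∃ X, spell g X = Y := by
  have : Y.reverse ∈ Set.range (List.map g) := by
    rw [Set.range_list_map]
    intro d hd
    rw [hr]
    exact hY d (by simpa using hd)
  obtain ⟨X, hX⟩ := this
  exact ⟨X, by rw [spell, hX, List.reverse_reverse]⟩

lemma bijective_spell (hg : Function.Injective g) (hr : Set.range g = {d | d < b ∧ d ∉ E}) :
    Function.Bijective (fun X => (⟨spell g X, spell_admissible hr X⟩ : AdmissibleString b E)) := by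
  refine ⟨fun X Y h => spell_injective hg (congrArg Subtype.val h), fun Y => ?_⟩
  obtain ⟨X, hX⟩ := exists_spell_eq hr Y.2
  exact ⟨X, Subtype.ext hX⟩

/-- The point of `[0, 1)` attached to the string spelled by `X`. -/
noncomputable def spellPoint (g : Fin (b - 1) → ℕ) (X : List (Fin (b - 1))) : ℝ :=
  Nat.ofDigits (b : ℝ) (spell g X) / (b : ℝ) ^ X.length

lemma spellPoint_nil : spellPoint g [] = 0 := by simp [spellPoint, spell, Nat.ofDigits]

lemma ofDigits_spell_append (X : List (Fin (b - 1))) (d : ℕ) :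
    Nat.ofDigits (b : ℝ) (spell g X ++ [d]) =
      Nat.ofDigits (b : ℝ) (spell g X) + (b : ℝ) ^ X.length * d := by
  rw [← Nat.coe_ofDigits ℝ, ← Nat.coe_ofDigits ℝ, Nat.ofDigits_append, length_spell]
  simp

lemma spellPoint_cons (hb : 2 ≤ b) (a : Fin (b - 1)) (X : List (Fin (b - 1))) :
    spellPoint g (a :: X) = (g a + spellPoint g X) / b := by
  have hb0 : (0 : ℝ) < b := by positivity
  rw [spellPoint, spellPoint, spell_cons, ofDigits_spell_append, List.length_cons, pow_succ]
  field_simp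
  ring

lemma spellPoint_mem (hb : 2 ≤ b) (hr : Set.range g = {d | d < b ∧ d ∉ E})
    (X : List (Fin (b - 1))) : spellPoint g X ∈ Set.Ico (0 : ℝ) 1 := by
  have hb0 : (0 : ℝ) < b := by positivity
  refine ⟨div_nonneg ?_ (by positivity), ?_⟩
  · rw [← Nat.coe_ofDigits ℝ]; positivity
  · rw [spellPoint, div_lt_one (by positivity), ← Nat.coe_ofDigits ℝ, ← length_spell (g := g)]
    exact_mod_cast Nat.ofDigits_lt_base_pow_length (by omega)
      fun d hd => (spell_admissible hr X d hd).1

variable {n : ℕ} {h : Fin n → ℕ}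

/-- The most significant digit `h p.1` is nonzero, so the string is already the canonical digit list
of its value. -/
lemma digits_ofDigits_spell (hb : 2 ≤ b) (hr : Set.range g = {d | d < b ∧ d ∉ E})
    (hh : Set.range h = {d | 0 < d ∧ d < b ∧ d ∉ E}) (p : Fin n × List (Fin (b - 1))) :
    Nat.digits b (Nat.ofDigits b (spell g p.2 ++ [h p.1])) = spell g p.2 ++ [h p.1] := by
  have hp : 0 < h p.1 ∧ h p.1 < b ∧ h p.1 ∉ E := hh.subset ⟨p.1, rfl⟩
  refine Nat.digits_ofDigits b (by omega) _ ?_ ?_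
  · intro d hd
    rcases List.mem_append.mp hd with hd | hd
    · exact (spell_admissible hr _ d hd).1
    · rw [List.mem_singleton.mp hd]; exact hp.2.1
  · intro _
    simpa using hp.1.ne'

lemma ofDigits_spell_mem (hb : 2 ≤ b) (hr : Set.range g = {d | d < b ∧ d ∉ E})
    (hh : Set.range h = {d | 0 < d ∧ d < b ∧ d ∉ E}) (p : Fin n × List (Fin (b - 1))) :
    Nat.ofDigits b (spell g p.2 ++ [h p.1]) ∈ kempnerSet b E := by
  have hp : 0 < h p.1 ∧ h p.1 < b ∧ h p.1 ∉ E := hh.subset ⟨p.1, rfl⟩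
  refine ⟨?_, ?_⟩
  · rw [Nat.ofDigits_append, Nat.ofDigits_singleton]
    have := hp.1
    positivity
  · rw [digits_ofDigits_spell hb hr hh]
    intro d hd
    rcases List.mem_append.mp hd with hd | hd
    · exact (spell_admissible hr _ d hd).2
    · rw [List.mem_singleton.mp hd]; exact hp.2.2

/-- `h` lists the possible leading digits: b - 1 of them when only 0 is excluded, b - 2 when only b
- 1 is. The last entry of `Nat.digits b m` recovers the leading digit and the preceding entries
recover the string. -/
lemma bijective_ofDigits_spell (hb : 2 ≤ b) (hg : Function.Injective g)
    (hr : Set.range g = {d | d < b ∧ d ∉ E}) (hi : Function.Injective h)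
    (hh : Set.range h = {d | 0 < d ∧ d < b ∧ d ∉ E}) :
    Function.Bijective (fun p : Fin n × List (Fin (b - 1)) =>
      (⟨_, ofDigits_spell_mem hb hr hh p⟩ : kempnerSet b E)) := by
  refine ⟨fun p q hpq => ?_, fun m => ?_⟩
  · have := congrArg (Nat.digits b) (congrArg Subtype.val hpq)
    simp only [digits_ofDigits_spell hb hr hh] at this
    obtain ⟨h1, h2⟩ := List.append_inj' this rfl
    exact Prod.ext (hi (by simpa using h2)) (spell_injective hg h1)
  · have hne : Nat.digits b m ≠ [] := Nat.digits_ne_nil_iff_ne_zero.mpr m.2.1.ne'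
    have hlast : (Nat.digits b m).getLast hne ∈ Set.range h := by
      rw [hh]
      exact ⟨Nat.pos_of_ne_zero (Nat.getLast_digit_ne_zero b m.2.1.ne'),
        Nat.digits_lt_base (by omega) (List.getLast_mem hne), m.2.2 _ (List.getLast_mem hne)⟩
    obtain ⟨c, hc⟩ := hlast
    obtain ⟨X, hX⟩ := exists_spell_eq hr (Y := (Nat.digits b m).dropLast) fun d hd =>
      ⟨Nat.digits_lt_base (by omega) (List.mem_of_mem_dropLast hd),
        m.2.2 _ (List.mem_of_mem_dropLast hd)⟩
    refine ⟨(c, X), Subtype.ext ?_⟩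
    simp only
    rw [hX, hc, List.dropLast_append_getLast, Nat.ofDigits_digits]

/-- The Kempner sum, split by leading digit. -/
lemma kempner_hasSum (hb : 2 ≤ b) (hg : Function.Injective g)
    (hr : Set.range g = {d | d < b ∧ d ∉ E}) (hi : Function.Injective h)
    (hh : Set.range h = {d | 0 < d ∧ d < b ∧ d ∉ E}) :
    HasSum (fun m : kempnerSet b E => 1 / ((m : ℕ) : ℝ))
      (∑ c : Fin n, ∑' X, 1 / ((h c : ℝ) + spellPoint g X) / (b : ℝ) ^ X.length) := by
  have hb0 : (0 : ℝ) < b := by positivity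
  have hs : Summable (fun p : Fin n × List (Fin (b - 1)) =>
      1 / ((h p.1 : ℝ) + spellPoint g p.2) / (b : ℝ) ^ p.2.length) := by
    have hw : Summable (fun p : Fin n × List (Fin (b - 1)) => 1 * (1 / (b : ℝ) ^ p.2.length)) :=
      Summable.mul_of_nonneg (hasSum_fintype (fun _ : Fin n => (1 : ℝ))).summable
        (summable_list_weight hb) (fun _ => zero_le_one) (fun _ => by positivity)
    refine Summable.of_nonneg_of_le (fun p => ?_) (fun p => ?_) hw
    · have := (spellPoint_mem hb hr p.2).1
      positivity
    -- The leading digit is at least 1, so each summand is at most the weight of its string.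
    · have h0 := (spellPoint_mem hb hr p.2).1
      have h1 : 0 < h p.1 := (hh.subset ⟨p.1, rfl⟩ : 0 < h p.1 ∧ _).1
      have h2 : (1 : ℝ) ≤ h p.1 := by exact_mod_cast h1
      rw [one_mul]
      gcongr
      rw [div_le_one (by linarith)]
      linarith
  rw [← (Equiv.ofBijective _ (bijective_ofDigits_spell hb hg hr hi hh)).hasSum_iff]
  have hp := hs.hasSum
  rw [hs.tsum_prod, tsum_fintype] at hp
  refine hp.congr_fun fun p => ?_
  simp only [Function.comp, Equiv.ofBijective_apply]
  -- The integer is b^|X| (h + x), with x the point of the string X.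
  rw [Nat.coe_ofDigits, ofDigits_spell_append, spellPoint, div_div]
  congr 1
  field_simp
  ring

lemma kempnerMeasure_eq_sum (hg : Function.Injective g)
    (hr : Set.range g = {d | d < b ∧ d ∉ E}) :
    kempnerMeasure b E = Measure.sum fun X : List (Fin (b - 1)) =>
      ((b : ℝ≥0∞)⁻¹ ^ X.length) • Measure.dirac (spellPoint g X) := by
  ext s hs
  rw [kempnerMeasure, Measure.sum_apply _ hs, Measure.sum_apply _ hs]
  refine Eq.trans (Equiv.tsum_eq (Equiv.ofBijective _ (bijective_spell hg hr)) _).symm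
    (tsum_congr fun X => ?_)
  simp only [Equiv.ofBijective_apply, length_spell]
  rfl

/-- Moments of the Kempner measure as sums over spelled strings. -/
lemma kempnerMoment_eq_tsum (hb : 2 ≤ b) (hg : Function.Injective g)
    (hr : Set.range g = {d | d < b ∧ d ∉ E}) (m : ℕ) :
    kempnerMoment b E m = ∑' X, spellPoint g X ^ m / (b : ℝ) ^ X.length := by
  have hb0 : (0 : ℝ) < b := by positivity
  have hmem (X : List (Fin (b - 1))) := spellPoint_mem hb hr X
  have hrestr : (kempnerMeasure b E).restrict (Set.Ico 0 1) = kempnerMeasure b E := by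
    refine Measure.restrict_eq_self_of_ae_mem ?_
    rw [kempnerMeasure_eq_sum hg hr]
    refine (Measure.ae_sum_iff' measurableSet_Ico).mpr fun X => Measure.ae_smul_measure ?_ _
    exact (ae_dirac_iff measurableSet_Ico).mpr (hmem X)
  have hc (X : List (Fin (b - 1))) : ((b : ℝ≥0∞)⁻¹ ^ X.length) ≠ ∞ :=
    ENNReal.pow_ne_top (ENNReal.inv_ne_top.mpr (by simp; omega))
  have hreal (X : List (Fin (b - 1))) :
      ((b : ℝ≥0∞)⁻¹ ^ X.length).toReal = 1 / (b : ℝ) ^ X.length := by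
    simp
  rw [kempnerMoment, hrestr, kempnerMeasure_eq_sum hg hr, integral_sum_dirac hc]
  refine tsum_congr fun X => ?_
  rw [hreal, smul_eq_mul]
  ring

end Strings

/-! ### Exact formulas for the two Kempner sums. -/

/-- Averaging the hypothesis, the sum over a becomes b times the mean of f by `ifsMean_eq`, since
f(ε) = 0; it cancels the same quantity on the right and leaves c times the total mass b. -/
lemma ifsMean_eq_of_functional_equation {b : ℕ} (hb : 2 ≤ b) {ε : ℝ} (hε : ε ∈ Set.Icc (0 : ℝ) 1)
    {f q : ℝ → ℝ} {c C : ℝ} (hf : ∀ y ∈ Set.Icc (0 : ℝ) 1, |f y| ≤ C) (hfε : f ε = 0)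
    (hq : ∀ y ∈ Set.Icc (0 : ℝ) 1,
      (∑ a : Fin (b - 1), f (((a : ℝ) + 1 + y) / b)) + q y = b * f y + c) :
    ifsMean b ε q = c * b := by
  have hb0 : (0 : ℝ) < b := by positivity
  have hmem (a : Fin (b - 1)) {y : ℝ} (hy : y ∈ Set.Icc (0 : ℝ) 1) :
      ((a : ℝ) + 1 + y) / b ∈ Set.Icc (0 : ℝ) 1 := by
    have := cast_fin_pred_le hb a
    have h0 := hy.1
    have h1 := hy.2
    exact ⟨by positivity, by rw [div_le_one hb0]; linarith⟩
  have hbd : ∀ y ∈ Set.Icc (0 : ℝ) 1, |b * f y| ≤ b * C := fun y hy => by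
    rw [abs_mul, abs_of_pos hb0]; gcongr; exact hf y hy
  have hsum : ∀ y ∈ Set.Icc (0 : ℝ) 1, |∑ a : Fin (b - 1), f (((a : ℝ) + 1 + y) / b)| ≤
      ∑ _a : Fin (b - 1), C := fun y hy =>
    (Finset.abs_sum_le_sum_abs _ _).trans (Finset.sum_le_sum fun a _ => hf _ (hmem a hy))
  have hqb : ∀ y ∈ Set.Icc (0 : ℝ) 1, |q y| ≤ b * C + |c| + ∑ _a : Fin (b - 1), C := by
    intro y hy
    have e : q y = b * f y + c - ∑ a : Fin (b - 1), f (((a : ℝ) + 1 + y) / b) := by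
      linarith [hq y hy]
    rw [e]
    exact (abs_sub _ _).trans (add_le_add ((abs_add_le _ _).trans
      (add_le_add (hbd y hy) le_rfl)) (hsum y hy))
  have h := ifsMean_congr hb hε hq
  rw [ifsMean_add hb hε hsum hqb,
    ifsMean_add hb hε (f := fun y => b * f y) (g := fun _ => c) hbd (fun _ _ => le_rfl),
    ifsMean_const hb hε, ifsMean_const_mul,
    ifsMean_sum hb hε Finset.univ (f := fun (a : Fin (b - 1)) y => f (((a : ℝ) + 1 + y) / b))
      (C := fun _ => C) (fun a _ y hy => hf _ (hmem a hy)),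
    ifsMean_eq hb hε hf, hfε] at h
  field_simp at h
  linarith

/-- Common core of both cases: `ε = 0`, `σ = 1` for excluded digit 0, and `ε = 1`, `σ = -1` for
excluded digit b - 1. The functions `p c` are the kernels 1/(h + x), one per leading digit. -/
lemma sum_ifsMean_eq {b n : ℕ} (hb : 2 ≤ b) {ε σ : ℝ} (hε : ε ∈ Set.Icc (0 : ℝ) 1)
    (hσ : |σ| ≤ 1) {f : ℝ → ℝ} {p : Fin n → ℝ → ℝ} {C : ℝ}
    (hf : ∀ y ∈ Set.Icc (0 : ℝ) 1, |f y| ≤ C) (hfε : f ε = 0)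
    (hp : ∀ c, ∀ y ∈ Set.Icc (0 : ℝ) 1, |p c y| ≤ 1)
    (h : ∀ y ∈ Set.Icc (0 : ℝ) 1, (∑ a : Fin (b - 1), f (((a : ℝ) + 1 + y) / b)) +
      harmonicExt (σ * y / b) = b * f y - b * Real.log b + b * ∑ c, p c y) :
    ∑ c, ifsMean b ε (p c) =
      b * Real.log b + ifsMean b ε (fun y => harmonicExt (σ * y / b)) / b := by
  have hb0 : (0 : ℝ) < b := by positivity
  have hb2 : (2 : ℝ) ≤ b := by exact_mod_cast hb
  have hφ : ∀ y ∈ Set.Icc (0 : ℝ) 1, |harmonicExt (σ * y / b)| ≤ 2 := by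
    intro y hy
    have h1 : |σ * y / b| ≤ 1 / 2 := by
      rw [abs_div, abs_mul, abs_of_pos hb0, abs_of_nonneg hy.1, div_le_div_iff₀ hb0 two_pos]
      have := mul_le_one₀ hσ hy.1 hy.2
      linarith
    have h2 := abs_harmonicExt_le (neg_le_of_abs_le h1)
    linarith
  have hP : ∀ y ∈ Set.Icc (0 : ℝ) 1, |-(b : ℝ) * ∑ c, p c y| ≤ b * ∑ _c : Fin n, (1 : ℝ) := by
    intro y hy
    rw [abs_mul, abs_neg, abs_of_pos hb0]
    gcongr
    exact (Finset.abs_sum_le_sum_abs _ _).trans (Finset.sum_le_sum fun c _ => hp c y hy)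
  have key := ifsMean_eq_of_functional_equation hb hε (c := -(b * Real.log b))
    (q := fun y => harmonicExt (σ * y / b) + -(b : ℝ) * ∑ c, p c y) hf hfε
    (fun y hy => by linarith [h y hy])
  rw [ifsMean_add hb hε hφ hP, ifsMean_const_mul,
    ifsMean_sum hb hε Finset.univ (C := fun _ => 1) (fun c _ => hp c)] at key
  field_simp
  linarith

lemma harmonicExt_multiplication_split {b : ℕ} (hb : 2 ≤ b) {x : ℝ} (hx : 0 ≤ x) :
    ∑ d ∈ Finset.range b, harmonicExt (((d : ℝ) + x) / b) =
      b * harmonicExt x - b * Real.log b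
        + b * ∑ d ∈ Finset.range (b - 1), 1 / ((d : ℝ) + 1 + x) := by
  have h := harmonicExt_multiplication (by omega : 1 ≤ b) hx
  have hb0 : (b : ℝ) ≠ 0 := by positivity
  rw [div_eq_iff hb0] at h
  rw [h]
  ring

lemma spellPoint_succ {b : ℕ} (hb : 2 ≤ b) (X : List (Fin (b - 1))) :
    spellPoint (fun a : Fin (b - 1) => (a : ℕ) + 1) X = ifsPoint b 0 X := by
  induction X with
  | nil => simp [spellPoint_nil, ifsPoint]
  | cons a X ih => rw [spellPoint_cons hb, ih, ifsPoint]; push_cast; rfl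

lemma cast_sub_two_sub {b : ℕ} (a : Fin (b - 1)) : ((b - 2 - (a : ℕ) : ℕ) : ℝ) = b - 2 - a := by
  have := a.2
  rw [Nat.cast_sub (by omega), Nat.cast_sub (by omega)]
  simp

/-- The reflection y ↦ 1 - y carries the digits 0, …, b - 2 to 1, …, b - 1 and the starting point 0
to 1, so one family of maps serves both exclusions. -/
lemma spellPoint_sub {b : ℕ} (hb : 2 ≤ b) (X : List (Fin (b - 1))) :
    spellPoint (fun a : Fin (b - 1) => b - 2 - (a : ℕ)) X = 1 - ifsPoint b 1 X := by
  have hb0 : (b : ℝ) ≠ 0 := by positivity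
  induction X with
  | nil => simp [spellPoint_nil, ifsPoint]
  | cons a X ih =>
    rw [spellPoint_cons hb, ih, ifsPoint, cast_sub_two_sub]
    field_simp
    ring

lemma range_succ_digit {b : ℕ} :
    Set.range (fun a : Fin (b - 1) => (a : ℕ) + 1) = {d | d < b ∧ d ∉ ({0} : Set ℕ)} := by
  ext d
  simp only [Set.mem_range, Set.mem_ofPred_eq, Set.mem_singleton_iff]
  constructor
  · rintro ⟨a, rfl⟩; have := a.2; omega
  · rintro ⟨h1, h2⟩; exact ⟨⟨d - 1, by omega⟩, by simp only; omega⟩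

lemma range_succ_lead {b : ℕ} :
    Set.range (fun a : Fin (b - 1) => (a : ℕ) + 1) = {d | 0 < d ∧ d < b ∧ d ∉ ({0} : Set ℕ)} := by
  rw [range_succ_digit]
  ext d
  simp only [Set.mem_ofPred_eq, Set.mem_singleton_iff]
  omega

lemma injective_succ_digit {n : ℕ} : Function.Injective (fun a : Fin n => (a : ℕ) + 1) :=
  fun a c h => Fin.ext (by simpa using h)

lemma range_sub_digit {b : ℕ} :
    Set.range (fun a : Fin (b - 1) => b - 2 - (a : ℕ)) = {d | d < b ∧ d ∉ ({b - 1} : Set ℕ)} := by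
  ext d
  simp only [Set.mem_range, Set.mem_ofPred_eq, Set.mem_singleton_iff]
  constructor
  · rintro ⟨a, rfl⟩; have := a.2; omega
  · rintro ⟨h1, h2⟩; exact ⟨⟨b - 2 - d, by omega⟩, by simp only; omega⟩

lemma range_sub_lead {b : ℕ} :
    Set.range (fun a : Fin (b - 2) => (a : ℕ) + 1) =
      {d | 0 < d ∧ d < b ∧ d ∉ ({b - 1} : Set ℕ)} := by
  ext d
  simp only [Set.mem_range, Set.mem_ofPred_eq, Set.mem_singleton_iff]
  constructor
  · rintro ⟨a, rfl⟩; have := a.2; omega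
  · rintro ⟨h1, h2⟩; exact ⟨⟨d - 1, by omega⟩, by simp only; omega⟩

lemma injective_sub_digit {b : ℕ} : Function.Injective (fun a : Fin (b - 1) => b - 2 - (a : ℕ)) :=
  fun a c h => Fin.ext (by have := a.2; have := c.2; simp only at h; omega)

lemma kempnerMoment_zero_eq {b : ℕ} (hb : 2 ≤ b) (m : ℕ) :
    kempnerMoment b {0} m = ifsMoment b 0 m := by
  rw [kempnerMoment_eq_tsum hb injective_succ_digit range_succ_digit]
  exact tsum_congr fun X => by rw [spellPoint_succ hb]

lemma kempner_zero_hasSum {b : ℕ} (hb : 2 ≤ b) :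
    HasSum (fun m : kempnerSet b {0} => 1 / ((m : ℕ) : ℝ))
      (b * Real.log b + ifsMean b 0 (fun y => harmonicExt (1 * y / b)) / b) := by
  have hb0 : (0 : ℝ) < b := by positivity
  have h := kempner_hasSum hb injective_succ_digit range_succ_digit injective_succ_digit
    range_succ_lead
  rw [← sum_ifsMean_eq hb (ε := 0) (σ := 1) (by simp) (by simp) (f := harmonicExt) (C := 4)
    (p := fun (c : Fin (b - 1)) y => 1 / ((c : ℝ) + 1 + y)) ?_ harmonicExt_zero ?_ ?_]
  · convert h using 3 with c
    exact tsum_congr fun X => by rw [spellPoint_succ hb]; push_cast; rfl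
  · intro y hy
    have h1 := abs_harmonicExt_le (s := y) (by linarith [hy.1])
    rw [abs_of_nonneg hy.1] at h1
    linarith [hy.2]
  · intro c y hy
    have := hy.1
    have hc : (0 : ℝ) ≤ c := by positivity
    rw [abs_of_pos (by positivity), div_le_one (by positivity)]
    linarith
  · intro y hy
    have h2 := harmonicExt_multiplication_split hb hy.1
    obtain ⟨k, rfl⟩ : ∃ k, b = k + 1 := ⟨b - 1, by omega⟩
    -- The summand d = 0, the excluded digit, is the correction H(y/b).
    rw [Finset.sum_range_succ'] at h2
    simp only [Nat.add_sub_cancel, Nat.cast_zero, zero_add] at h2 ⊢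
    rw [Finset.sum_range, Finset.sum_range] at h2
    push_cast at h2 ⊢
    rw [one_mul]
    exact h2

lemma kempner_pred_hasSum {b : ℕ} (hb : 2 ≤ b) :
    HasSum (fun m : kempnerSet b {b - 1} => 1 / ((m : ℕ) : ℝ))
      (b * Real.log b + ifsMean b 1 (fun y => harmonicExt (-1 * y / b)) / b) := by
  have hb0 : (0 : ℝ) < b := by positivity
  have h := kempner_hasSum hb injective_sub_digit range_sub_digit injective_succ_digit
    range_sub_lead
  rw [← sum_ifsMean_eq hb (ε := 1) (σ := -1) (by simp) (by simp)
    (f := fun y => harmonicExt (1 - y)) (C := 4)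
    (p := fun (c : Fin (b - 2)) y => 1 / ((c : ℝ) + 1 + (1 - y))) ?_
    (by simp [harmonicExt_zero]) ?_ ?_]
  · convert h using 3 with c
    exact tsum_congr fun X => by rw [spellPoint_sub hb]; push_cast; rfl
  · intro y hy
    have h1 := abs_harmonicExt_le (s := 1 - y) (by linarith [hy.2])
    rw [abs_of_nonneg (a := 1 - y) (by linarith [hy.2])] at h1
    linarith [hy.1]
  · intro c y hy
    have : 0 ≤ 1 - y := by linarith [hy.2]
    have hc : (0 : ℝ) ≤ c := by positivity
    rw [abs_of_pos (by positivity), div_le_one (by positivity)]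
    linarith
  · intro y hy
    have h2 := harmonicExt_multiplication_split hb (x := 1 - y) (by linarith [hy.2])
    obtain ⟨k, rfl⟩ : ∃ k, b = k + 2 := ⟨b - 2, by omega⟩
    have e1 : k + 2 - 1 = k + 1 := rfl
    have e2 : k + 2 - 2 = k := rfl
    -- At x = 1 - y the excluded digit d = b - 1 contributes H(1 - y/b), while 1/(b - y) has no
    -- leading digit to match it. As b/(b - y) = 1/(1 - y/b), the two combine to H(-y/b) by
    -- `harmonicExt_sub_one`. The other digits are matched by the reversal d = b - 2 - i.
    rw [e1, Finset.sum_range_succ, Finset.sum_range_succ (fun d : ℕ => 1 / ((d : ℝ) + 1 + (1 - y))),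
      ← Finset.sum_range_reflect] at h2
    rw [e1, e2, ← Finset.sum_range (fun i => harmonicExt (1 - ((i : ℝ) + 1 + y) / (k + 2 : ℕ))),
      ← Finset.sum_range (fun i => 1 / ((i : ℝ) + 1 + (1 - y)))]
    have e3 : ∑ j ∈ Finset.range (k + 1),
        harmonicExt ((((k + 1 - 1 - j : ℕ) : ℝ) + (1 - y)) / (k + 2 : ℕ)) =
        ∑ i ∈ Finset.range (k + 1), harmonicExt (1 - ((i : ℝ) + 1 + y) / (k + 2 : ℕ)) := by
      refine Finset.sum_congr rfl fun i hi => ?_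
      have hi' : i ≤ k := by have := Finset.mem_range.mp hi; omega
      rw [Nat.add_sub_cancel, Nat.cast_sub hi']
      congr 1
      push_cast
      field_simp
      ring
    have e4 : (((k + 1 : ℕ) : ℝ) + (1 - y)) / (k + 2 : ℕ) = 1 - y / (k + 2 : ℕ) := by
      push_cast
      field_simp
      ring
    have hk : (2 : ℝ) ≤ ((k + 2 : ℕ) : ℝ) := by push_cast; linarith [(Nat.cast_nonneg k : (0 : ℝ) ≤ k)]
    have e5 : harmonicExt (-1 * y / (k + 2 : ℕ)) =
        harmonicExt (1 - y / (k + 2 : ℕ)) - 1 / (1 - y / (k + 2 : ℕ)) := by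
      rw [← harmonicExt_sub_one]
      · congr 1; ring
      · have : y / ((k + 2 : ℕ) : ℝ) ≤ 1 / 2 := by
          rw [div_le_div_iff₀ hb0 two_pos]; linarith [hy.2]
        linarith
    have e6 : 1 / (1 - y / ((k + 2 : ℕ) : ℝ)) = (k + 2 : ℕ) * (1 / ((k : ℝ) + 1 + (1 - y))) := by
      have h3 : ((k + 2 : ℕ) : ℝ) - y ≠ 0 := by linarith [hy.2]
      have h4 : (k : ℝ) + 1 + (1 - y) = ((k + 2 : ℕ) : ℝ) - y := by push_cast; ring
      rw [h4]
      field_simp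
    rw [e3, e4] at h2
    rw [e5, e6]
    linarith

/-! ### The correction term as a series of moments. -/

/-- The expansion of the correction term in powers of `1 / b`. -/
lemma ifsMean_harmonicExt_hasSum {b : ℕ} (hb : 2 ≤ b) {ε σ : ℝ} (hε : ε ∈ Set.Icc (0 : ℝ) 1)
    (hσ : |σ| ≤ 1) :
    HasSum (fun m : ℕ => (-1 : ℝ) ^ m * σ ^ (m + 1) * zetaValue (m + 2) * ifsMoment b ε (m + 1)
        / (b : ℝ) ^ (m + 2))
      (ifsMean b ε (fun y => harmonicExt (σ * y / b)) / b) := by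
  have hb0 : (0 : ℝ) < b := by positivity
  have hb2 : (2 : ℝ) ≤ b := by exact_mod_cast hb
  have hgeo : Summable (fun m : ℕ => 2 * (1 / 2 : ℝ) ^ m) :=
    (summable_geometric_of_lt_one (by norm_num) (by norm_num)).mul_left _
  have hle {y : ℝ} (hy : y ∈ Set.Icc (0 : ℝ) 1) : |σ * y / b| ≤ 1 / 2 := by
    rw [abs_div, abs_mul, abs_of_pos hb0, abs_of_nonneg hy.1, div_le_div_iff₀ hb0 two_pos]
    have := mul_le_one₀ hσ hy.1 hy.2
    linarith
  -- As b ≥ 2, the argument of H is at most 1/2 in absolute value; with ζ ≤ 2 the double series is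
  -- dominated by the string weights times 2 · 2^(-m).
  have hsum : Summable (fun p : List (Fin (b - 1)) × ℕ =>
      (-1 : ℝ) ^ p.2 * zetaValue (p.2 + 2) * (σ * ifsPoint b ε p.1 / b) ^ (p.2 + 1)
        / (b : ℝ) ^ p.1.length) := by
    refine Summable.of_norm_bounded ((summable_list_weight hb).mul_of_nonneg hgeo
      (fun _ => by positivity) (fun _ => by positivity)) fun p => ?_
    have h1 := hle (ifsPoint_mem hb hε p.1)
    rw [norm_div, norm_mul, norm_mul, norm_pow, norm_neg, norm_one, one_pow, one_mul, norm_pow,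
      norm_pow, Real.norm_eq_abs, Real.norm_eq_abs, Real.norm_eq_abs, abs_of_pos hb0,
      abs_of_pos (zetaValue_pos (by omega)), div_eq_mul_one_div, mul_comm]
    have h2 : |σ * ifsPoint b ε p.1 / b| ^ (p.2 + 1) ≤ (1 / 2) ^ p.2 :=
      (pow_le_pow_left₀ (abs_nonneg _) h1 _).trans
        (pow_le_pow_of_le_one (by norm_num) (by norm_num) p.2.le_succ)
    have h3 : zetaValue (p.2 + 2) ≤ 2 := zetaValue_le_two (by omega)
    gcongr
  have hswap := hsum.prod_symm
  have h2 := hswap.hasSum.prod_fiberwise fun m => (hswap.prod_factor m).hasSum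
  have h1 : ifsMean b ε (fun y => harmonicExt (σ * y / b)) = ∑' p : List (Fin (b - 1)) × ℕ,
      (-1 : ℝ) ^ p.2 * zetaValue (p.2 + 2) * (σ * ifsPoint b ε p.1 / b) ^ (p.2 + 1)
        / (b : ℝ) ^ p.1.length := by
    rw [hsum.tsum_prod]
    exact tsum_congr fun X =>
      ((harmonicExt_hasSum (hle (ifsPoint_mem hb hε X))).div_const _).tsum_eq.symm
  rw [h1, ← (Equiv.prodComm ℕ (List (Fin (b - 1)))).tsum_eq]
  refine (h2.div_const (b : ℝ)).congr_fun fun m => ?_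
  simp only [Prod.swap, ifsMoment, ifsMean]
  rw [← tsum_mul_left, ← tsum_div_const, ← tsum_div_const]
  refine tsum_congr fun X => ?_
  rw [div_pow, mul_pow]
  field_simp
  ring

/-- Since ζ ≤ 2 and every moment is at most b, the m-th term is at most 2 b^(-m-1); the tail is
geometric of ratio 1/b ≤ 1/2, which doubles the constant to 4. -/
lemma abs_ifsMean_harmonicExt_sub_le {b : ℕ} (hb : 2 ≤ b) {ε σ : ℝ} (hε : ε ∈ Set.Icc (0 : ℝ) 1)
    (hσ : |σ| ≤ 1) (M : ℕ) :
    |ifsMean b ε (fun y => harmonicExt (σ * y / b)) / b - ∑ m ∈ Finset.range M,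
      (-1 : ℝ) ^ m * σ ^ (m + 1) * zetaValue (m + 2) * ifsMoment b ε (m + 1) / (b : ℝ) ^ (m + 2)| ≤
      4 * (1 / (b : ℝ) ^ (M + 1)) := by
  have hb0 : (0 : ℝ) < b := by positivity
  have hb2 : (2 : ℝ) ≤ b := by exact_mod_cast hb
  have hr : 1 / (b : ℝ) ≤ 1 / 2 := one_div_le_one_div_of_le two_pos hb2
  have h := dist_le_of_le_geometric_of_tendsto (1 / (b : ℝ)) (2 / b) (by linarith) (fun m => ?_)
    (ifsMean_harmonicExt_hasSum hb hε hσ).tendsto_sum_nat M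
  · rw [dist_comm, Real.dist_eq] at h
    refine h.trans ?_
    rw [div_le_iff₀ (by linarith), div_pow, one_pow]
    have e : 2 / (b : ℝ) * (1 / (b : ℝ) ^ M) = 2 * (1 / (b : ℝ) ^ (M + 1)) := by
      rw [pow_succ]; field_simp
    have hp : 0 < 1 / (b : ℝ) ^ (M + 1) := by positivity
    rw [e]
    nlinarith
  · rw [Finset.sum_range_succ, dist_self_add_right, norm_div, norm_mul, norm_mul, norm_mul,
      norm_pow, norm_pow, norm_neg, norm_one, one_pow, one_mul, norm_pow, Real.norm_eq_abs,
      Real.norm_eq_abs, Real.norm_eq_abs, Real.norm_eq_abs, abs_of_pos hb0,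
      abs_of_nonneg (ifsMoment_nonneg hb hε _), abs_of_pos (zetaValue_pos (by omega))]
    have h1 : zetaValue (m + 2) ≤ 2 := zetaValue_le_two (by omega)
    have h2 := ifsMoment_le hb hε (m + 1)
    have h3 : |σ| ^ (m + 1) ≤ 1 := pow_le_one₀ (abs_nonneg _) hσ
    have h0 := ifsMoment_nonneg hb hε (m + 1)
    have hz : 0 < zetaValue (m + 2) := zetaValue_pos (by omega)
    calc |σ| ^ (m + 1) * zetaValue (m + 2) * ifsMoment b ε (m + 1) / (b : ℝ) ^ (m + 2)
        ≤ 1 * 2 * b / (b : ℝ) ^ (m + 2) := by gcongr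
      _ = 2 / b * (1 / b) ^ m := by rw [div_pow, one_pow]; field_simp; ring

/-! ### The first three moments. -/

lemma sum_fin_succ_pow {b : ℕ} (hb : 2 ≤ b) {p : ℕ} (hp : p ≠ 0) :
    ∑ a : Fin (b - 1), ((a : ℝ) + 1) ^ p = ∑ k ∈ Finset.range b, (k : ℝ) ^ p := by
  obtain ⟨k, rfl⟩ : ∃ k, b = k + 1 := ⟨b - 1, by omega⟩
  rw [Finset.sum_range_succ', Finset.sum_range]
  simp [hp]

lemma sum_range_cast_one (b : ℕ) :
    ∑ k ∈ Finset.range b, (k : ℝ) ^ 1 = b * (b - 1) / 2 := by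
  induction b with
  | zero => simp
  | succ n ih => rw [Finset.sum_range_succ, ih]; push_cast; ring

lemma sum_range_cast_sq (b : ℕ) :
    ∑ k ∈ Finset.range b, (k : ℝ) ^ 2 = b * (b - 1) * (2 * b - 1) / 6 := by
  induction b with
  | zero => simp
  | succ n ih => rw [Finset.sum_range_succ, ih]; push_cast; ring

lemma sum_range_cast_cube (b : ℕ) :
    ∑ k ∈ Finset.range b, (k : ℝ) ^ 3 = (b : ℝ) ^ 2 * (b - 1) ^ 2 / 4 := by
  induction b with
  | zero => simp
  | succ n ih => rw [Finset.sum_range_succ, ih]; push_cast; ring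

lemma ifsMoment_one {b : ℕ} (hb : 2 ≤ b) {ε : ℝ} (hε : ε ∈ Set.Icc (0 : ℝ) 1) :
    ((b : ℝ) ^ 2 - b + 1) * ifsMoment b ε 1 = ε * (b : ℝ) ^ 2 + b ^ 2 * (b - 1) / 2 := by
  have h := ifsMoment_recurrence hb hε 1
  simp only [Finset.sum_range_one, Nat.choose_zero_right, Nat.sub_zero, Nat.cast_one, one_mul,
    sum_fin_succ_pow hb one_ne_zero, sum_range_cast_one, ifsMoment_zero hb hε, Nat.reduceAdd,
    pow_one ε] at h
  rw [h]
  ring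

lemma ifsMoment_two {b : ℕ} (hb : 2 ≤ b) {ε : ℝ} (hε : ε ∈ Set.Icc (0 : ℝ) 1) :
    ((b : ℝ) ^ 3 - b + 1) * ifsMoment b ε 2 = ε ^ 2 * (b : ℝ) ^ 3 +
      b ^ 2 * (b - 1) * (2 * b - 1) / 6 + b * (b - 1) * ifsMoment b ε 1 := by
  have h := ifsMoment_recurrence hb hε 2
  simp only [Finset.sum_range_succ, Finset.sum_range_zero, Nat.choose_zero_right,
    Nat.choose_one_right, Nat.sub_zero, Nat.cast_one, one_mul, zero_add, Nat.cast_ofNat,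
    Nat.add_one_sub_one, sum_fin_succ_pow hb one_ne_zero, sum_fin_succ_pow hb two_ne_zero,
    sum_range_cast_one, sum_range_cast_sq, ifsMoment_zero hb hε, Nat.reduceAdd] at h
  rw [h]
  ring

lemma ifsMoment_three {b : ℕ} (hb : 2 ≤ b) {ε : ℝ} (hε : ε ∈ Set.Icc (0 : ℝ) 1) :
    ((b : ℝ) ^ 4 - b + 1) * ifsMoment b ε 3 = ε ^ 3 * (b : ℝ) ^ 4 + b ^ 3 * (b - 1) ^ 2 / 4 +
      b * (b - 1) * (2 * b - 1) / 2 * ifsMoment b ε 1 + 3 * b * (b - 1) / 2 * ifsMoment b ε 2 := by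
  have h := ifsMoment_recurrence hb hε 3
  have hc : Nat.choose 3 2 = 3 := rfl
  simp only [Finset.sum_range_succ, Finset.sum_range_zero, Nat.choose_zero_right, hc,
    Nat.choose_one_right, Nat.sub_zero, Nat.cast_one, one_mul, zero_add, Nat.cast_ofNat,
    Nat.add_one_sub_one, Nat.reduceSub, sum_fin_succ_pow hb one_ne_zero,
    sum_fin_succ_pow hb two_ne_zero, sum_fin_succ_pow hb three_ne_zero, sum_range_cast_one,
    sum_range_cast_sq, sum_range_cast_cube, ifsMoment_zero hb hε, Nat.reduceAdd] at h
  rw [h]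
  ring

lemma sq_sub_add_one_pos {b : ℝ} (hb : 2 ≤ b) : 0 < b ^ 2 - b + 1 := by nlinarith

lemma cube_sub_add_one_pos {b : ℝ} (hb : 2 ≤ b) : 0 < b ^ 3 - b + 1 := by
  nlinarith [mul_nonneg (sub_nonneg.mpr hb) (sq_nonneg b)]

lemma ifsMoment_zero_one_div {b : ℕ} (hb : 2 ≤ b) :
    ifsMoment b 0 1 / (b : ℝ) ^ 2 = 1 / (2 * b) - 1 / (2 * b * ((b : ℝ) ^ 2 - b + 1)) := by
  have hb2 : (2 : ℝ) ≤ b := by exact_mod_cast hb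
  have h1 := ifsMoment_one hb (ε := 0) (by simp)
  have hA := (sq_sub_add_one_pos hb2).ne'
  obtain ⟨A, hAd⟩ : ∃ A, A = (b : ℝ) ^ 2 - b + 1 := ⟨_, rfl⟩
  rw [← hAd] at h1 hA ⊢
  have e1 : ifsMoment b 0 1 = ((b : ℝ) ^ 2 * (b - 1) / 2) / A := by
    rw [eq_div_iff hA]
    linarith
  rw [e1]
  field_simp
  rw [hAd]
  ring

lemma ifsMoment_zero_two_div {b : ℕ} (hb : 2 ≤ b) :
    ifsMoment b 0 2 / (b : ℝ) ^ 3 = 1 / (3 * (b : ℝ) ^ 2) - (5 * (b : ℝ) ^ 2 - 5 * b + 2)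
      / (6 * (b : ℝ) ^ 2 * ((b : ℝ) ^ 2 - b + 1) * ((b : ℝ) ^ 3 - b + 1)) := by
  have hb2 : (2 : ℝ) ≤ b := by exact_mod_cast hb
  have h1 := ifsMoment_one hb (ε := 0) (by simp)
  have h2 := ifsMoment_two hb (ε := 0) (by simp)
  have hA := (sq_sub_add_one_pos hb2).ne'
  have hB := (cube_sub_add_one_pos hb2).ne'
  obtain ⟨A, hAd⟩ : ∃ A, A = (b : ℝ) ^ 2 - b + 1 := ⟨_, rfl⟩
  obtain ⟨B, hBd⟩ : ∃ B, B = (b : ℝ) ^ 3 - b + 1 := ⟨_, rfl⟩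
  rw [← hAd] at h1 hA ⊢
  rw [← hBd] at h2 hB ⊢
  have e1 : ifsMoment b 0 1 = ((b : ℝ) ^ 2 * (b - 1) / 2) / A := by
    rw [eq_div_iff hA]
    linarith
  have e2 : ifsMoment b 0 2 = ((b : ℝ) ^ 2 * (b - 1) * (2 * b - 1) / 6 + b * (b - 1) *
      (((b : ℝ) ^ 2 * (b - 1) / 2) / A)) / B := by
    rw [eq_div_iff hB, ← e1]
    linarith
  rw [e2]
  field_simp
  rw [hAd, hBd]
  ring

/-- The closed forms give u₁ ≤ b/2 and u₂ ≤ b/3. Inserted in the recurrence for u₃, they fall short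
of (b^4 - b + 1) b/4 by exactly b/4, whence strictness. -/
lemma ifsMoment_zero_three_lt {b : ℕ} (hb : 2 ≤ b) : ifsMoment b 0 3 < (b : ℝ) / 4 := by
  have hb2 : (2 : ℝ) ≤ b := by exact_mod_cast hb
  have hA := sq_sub_add_one_pos hb2
  have hB := cube_sub_add_one_pos hb2
  have hC : 0 < (b : ℝ) ^ 4 - b + 1 := by
    have := pow_le_pow_right₀ (by linarith : (1 : ℝ) ≤ b) (show 3 ≤ 4 by omega)
    linarith
  have h1 : ifsMoment b 0 1 ≤ b / 2 := by
    have h := ifsMoment_zero_one_div hb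
    have : 0 ≤ 1 / (2 * b * ((b : ℝ) ^ 2 - b + 1)) := by positivity
    have h' : ifsMoment b 0 1 / (b : ℝ) ^ 2 ≤ 1 / (2 * b) := by linarith
    rw [div_le_iff₀ (by positivity)] at h'
    refine h'.trans_eq ?_
    field_simp
  have h2 : ifsMoment b 0 2 ≤ b / 3 := by
    have h := ifsMoment_zero_two_div hb
    have : 0 ≤ (5 * (b : ℝ) ^ 2 - 5 * b + 2)
      / (6 * (b : ℝ) ^ 2 * ((b : ℝ) ^ 2 - b + 1) * ((b : ℝ) ^ 3 - b + 1)) :=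
      div_nonneg (by nlinarith) (by positivity)
    have h' : ifsMoment b 0 2 / (b : ℝ) ^ 3 ≤ 1 / (3 * (b : ℝ) ^ 2) := by linarith
    rw [div_le_iff₀ (by positivity)] at h'
    refine h'.trans_eq ?_
    field_simp
  have h3 := ifsMoment_three hb (ε := 0) (by simp)
  have c1 : 0 ≤ (b : ℝ) * (b - 1) * (2 * b - 1) / 2 :=
    div_nonneg (mul_nonneg (mul_nonneg (by linarith) (by linarith)) (by linarith)) two_pos.le
  have c2 : 0 ≤ 3 * (b : ℝ) * (b - 1) / 2 :=
    div_nonneg (mul_nonneg (by linarith) (by linarith)) two_pos.le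
  have m1 := mul_le_mul_of_nonneg_left h1 c1
  have m2 := mul_le_mul_of_nonneg_left h2 c2
  refine lt_of_mul_lt_mul_left ?_ hC.le
  have e : ((b : ℝ) ^ 4 - b + 1) * (b / 4) = b ^ 3 * (b - 1) ^ 2 / 4 +
      b * (b - 1) * (2 * b - 1) / 2 * (b / 2) + 3 * b * (b - 1) / 2 * (b / 3) + b / 4 := by ring
  rw [h3, e]
  linarith

/-! ### Strict alternating bounds. -/

/-- The alternating series bounds, strict because the terms decrease strictly. -/
lemma alternating_partial_sums_lt {f : ℕ → ℝ} {l : ℝ} (hf : StrictAnti f)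
    (hl : Tendsto (fun n => ∑ i ∈ Finset.range n, (-1 : ℝ) ^ i * f i) atTop (nhds l)) (k : ℕ) :
    ∑ i ∈ Finset.range (2 * k), (-1 : ℝ) ^ i * f i < l ∧
      l < ∑ i ∈ Finset.range (2 * k + 1), (-1 : ℝ) ^ i * f i := by
  have he : (-1 : ℝ) ^ (2 * k) = 1 := by simp
  -- The weak bounds are taken one pair of terms later, at k + 1; that pair has a strict sign, which
  -- makes the bounds at k strict.
  have h1 := hf.antitone.alternating_series_le_tendsto hl (k + 1)
  have h2 := hf.antitone.tendsto_le_alternating_series hl (k + 1)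
  rw [show 2 * (k + 1) = 2 * k + 1 + 1 by ring] at h1 h2
  simp only [Finset.sum_range_succ, pow_succ, he] at h1 h2 ⊢
  have h3 := hf (Nat.lt_succ_self (2 * k))
  have h4 := hf (Nat.lt_succ_self (2 * k + 1))
  constructor <;> simp only [Nat.succ_eq_add_one] at h3 h4 <;> linarith

/-- Zeta values and moments decrease weakly; strictness comes from the power of b > 1. -/
lemma strictAnti_zeta_mul_ifsMoment {b : ℕ} (hb : 2 ≤ b) {ε : ℝ} (hε : ε ∈ Set.Icc (0 : ℝ) 1) :
    StrictAnti fun m : ℕ => zetaValue (m + 2) * ifsMoment b ε (m + 1) / (b : ℝ) ^ (m + 2) := by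
  refine strictAnti_nat_of_succ_lt fun m => ?_
  have hb0 : (0 : ℝ) < b := by positivity
  have hb1 : (1 : ℝ) < b := by exact_mod_cast hb
  have hz : 0 < zetaValue (m + 2) := zetaValue_pos (by omega)
  have hw := ifsMoment_pos hb hε (m + 1)
  have hw' := ifsMoment_pos hb hε (m + 2)
  have h1 : zetaValue (m + 3) ≤ zetaValue (m + 2) := zetaValue_succ_le (by omega)
  have h2 := ifsMoment_succ_le hb hε (m + 1)
  calc zetaValue (m + 3) * ifsMoment b ε (m + 2) / (b : ℝ) ^ (m + 3)
      ≤ zetaValue (m + 2) * ifsMoment b ε (m + 1) / (b : ℝ) ^ (m + 3) := by gcongr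
    _ < zetaValue (m + 2) * ifsMoment b ε (m + 1) / (b : ℝ) ^ (m + 2) :=
      div_lt_div_of_pos_left (by positivity) (by positivity)
        (pow_lt_pow_right₀ hb1 (by omega))

/-! ### Full expansions in powers of 1/b. -/

lemma AnalyticAt.exists_isBigO_one_div {F : ℝ → ℝ} (hF : AnalyticAt ℝ F 0) :
    ∃ e : ℕ → ℝ, ∀ M : ℕ,
      (fun b : ℕ => F (1 / b) - ∑ i ∈ Finset.range M, e i * (1 / (b : ℝ)) ^ i)
        =O[atTop] fun b : ℕ => (1 / (b : ℝ)) ^ M := by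
  obtain ⟨p, hp⟩ := hF
  refine ⟨p.coeff, fun M => ?_⟩
  have h := (hp.isBigO_sub_partialSum_pow M).comp_tendsto
    (tendsto_one_div_atTop_nhds_zero_nat (𝕜 := ℝ))
  refine (h.congr_left fun b => ?_).trans (isBigO_of_le _ fun b => ?_)
  · simp only [Function.comp, zero_add, FormalMultilinearSeries.partialSum,
      FormalMultilinearSeries.apply_eq_pow_smul_coeff, smul_eq_mul]
    congr 1
    exact Finset.sum_congr rfl fun i _ => mul_comm _ _
  · simp

/-- Faulhaber's formula, as a polynomial in `1 / b`. -/
lemma sum_fin_succ_pow_div {b : ℕ} (hb : 2 ≤ b) {p : ℕ} (hp : p ≠ 0) :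
    (∑ a : Fin (b - 1), ((a : ℝ) + 1) ^ p) / (b : ℝ) ^ (p + 1) =
      ∑ i ∈ Finset.range (p + 1),
        ((bernoulli i : ℚ) : ℝ) * (p + 1).choose i / (p + 1) * (1 / (b : ℝ)) ^ i := by
  have hb0 : (b : ℝ) ≠ 0 := by positivity
  rw [sum_fin_succ_pow hb hp]
  have h : ∑ k ∈ Finset.range b, (k : ℝ) ^ p = ∑ i ∈ Finset.range (p + 1),
      ((bernoulli i : ℚ) : ℝ) * (p + 1).choose i * (b : ℝ) ^ (p + 1 - i) / (p + 1) := by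
    exact_mod_cast congrArg (fun q : ℚ => (q : ℝ)) (sum_range_pow b p)
  rw [h, Finset.sum_div]
  refine Finset.sum_congr rfl fun i hi => ?_
  have hi' : i ≤ p + 1 := (Finset.mem_range.mp hi).le
  rw [div_pow, one_pow, ← Nat.sub_add_cancel hi', pow_add, Nat.sub_add_cancel hi']
  field_simp

/-- The normalized moments are analytic functions of `1 / b`. -/
lemma exists_analyticAt_ifsMoment {ε : ℝ} (hε : ε ∈ Set.Icc (0 : ℝ) 1) (m : ℕ) :
    ∃ F : ℝ → ℝ, AnalyticAt ℝ F 0 ∧ ∀ b : ℕ, 2 ≤ b → ifsMoment b ε m / b = F (1 / b) := by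
  induction m using Nat.strong_induction_on with
  | _ m ih =>
  -- The case m = 0 is separate because the denominator 1 - t^m + t^(m+1) used below would vanish at
  -- t = 0; for m > 0 it equals 1 there.
  rcases Nat.eq_zero_or_pos m with rfl | hm
  · refine ⟨fun _ => 1, analyticAt_const, fun b hb => ?_⟩
    have hb0 : (b : ℝ) ≠ 0 := by positivity
    rw [ifsMoment_zero hb hε, div_self hb0]
  choose! F hF hFb using ih
  -- This is the moment recurrence divided by b^(m+2), with t = 1/b and the power sums replaced by
  -- Faulhaber polynomials in t.
  refine ⟨fun t => (ε ^ m * t + ∑ j ∈ Finset.range m, (m.choose j : ℝ) *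
    (∑ i ∈ Finset.range (m - j + 1), ((bernoulli i : ℚ) : ℝ) * (m - j + 1).choose i /
      ((m - j : ℕ) + 1) * t ^ i) * t ^ j * F j t) / (1 - t ^ m + t ^ (m + 1)), ?_, fun b hb => ?_⟩
  · refine AnalyticAt.div (AnalyticAt.add (by fun_prop)
      (Finset.analyticAt_fun_sum _ fun j hj => ?_)) (by fun_prop) (by simp [hm.ne'])
    have := hF j (Finset.mem_range.mp hj)
    exact ((analyticAt_const.mul (Finset.analyticAt_fun_sum _ fun i _ => by fun_prop)).mul
      (by fun_prop)).mul this
  · have hb0 : (0 : ℝ) < b := by positivity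
    have hb1 : (1 : ℝ) < b := by exact_mod_cast hb
    have hden : 0 < (b : ℝ) ^ (m + 1) - b + 1 := by
      have := le_self_pow₀ hb1.le (show m + 1 ≠ 0 by omega)
      linarith
    have hden' : 1 - (1 / (b : ℝ)) ^ m + (1 / (b : ℝ)) ^ (m + 1) =
        ((b : ℝ) ^ (m + 1) - b + 1) / (b : ℝ) ^ (m + 1) := by
      rw [div_pow, div_pow, one_pow, one_pow, pow_succ]
      field_simp
    have hterm : ∑ j ∈ Finset.range m, (m.choose j : ℝ) *
        (∑ i ∈ Finset.range (m - j + 1), ((bernoulli i : ℚ) : ℝ) * (m - j + 1).choose i /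
          ((m - j : ℕ) + 1) * (1 / (b : ℝ)) ^ i) * (1 / (b : ℝ)) ^ j * F j (1 / b) =
        (∑ j ∈ Finset.range m, (m.choose j : ℝ) * (∑ a : Fin (b - 1), ((a : ℝ) + 1) ^ (m - j)) *
          ifsMoment b ε j) / (b : ℝ) ^ (m + 2) := by
      rw [Finset.sum_div]
      refine Finset.sum_congr rfl fun j hj => ?_
      have hj' := Finset.mem_range.mp hj
      rw [← sum_fin_succ_pow_div hb (by omega), ← hFb j hj' b hb]
      have hpow : (b : ℝ) ^ (m + 2) = (b : ℝ) ^ (m - j + 1) * (b : ℝ) ^ j * b := by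
        rw [← pow_add, ← pow_succ]; congr 1; omega
      rw [hpow, div_pow, one_pow]
      field_simp
    simp only
    rw [hden', hterm, div_eq_div_iff hb0.ne' (by positivity)]
    have h := ifsMoment_recurrence hb hε m
    rw [mul_div_assoc', div_eq_iff (by positivity), mul_comm (ifsMoment b ε m), h]
    field_simp
    ring

lemma sum_triangle (g : ℕ → ℕ → ℝ) (M : ℕ) :
    ∑ m ∈ Finset.range M, ∑ i ∈ Finset.range (M - m), g m i =
      ∑ k ∈ Finset.range M, ∑ m ∈ Finset.range (k + 1), g m (k - m) := by
  induction M with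
  | zero => simp
  | succ M ih =>
    rw [Finset.sum_range_succ _ M, Finset.sum_range_succ _ M, ← ih, Finset.sum_range_succ _ M,
      ← add_assoc, ← Finset.sum_add_distrib]
    congr 1
    · refine Finset.sum_congr rfl fun m hm => ?_
      rw [Nat.succ_sub (Finset.mem_range.mp hm).le, Finset.sum_range_succ]
    · simp

lemma sum_Icc_one_eq_sum_range (f : ℕ → ℝ) (M : ℕ) :
    ∑ k ∈ Finset.Icc 1 M, f k = ∑ k ∈ Finset.range M, f (k + 1) := by
  induction M with
  | zero => simp
  | succ M ih => rw [Finset.sum_Icc_succ_top (by omega), ih, Finset.sum_range_succ]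

lemma hasFullExpansion_ifsMean {ε σ : ℝ} (hε : ε ∈ Set.Icc (0 : ℝ) 1) (hσ : |σ| ≤ 1) :
    ∃ a : ℕ → ℝ, HasFullExpansion
      (fun b : ℕ => ifsMean b ε (fun y => harmonicExt (σ * y / b)) / b) a := by
  choose F hF hFb using exists_analyticAt_ifsMoment hε
  choose e he using fun m => (hF m).exists_isBigO_one_div
  set c : ℕ → ℝ := fun m => (-1 : ℝ) ^ m * σ ^ (m + 1) * zetaValue (m + 2) with hc
  -- The m-th term of the series is c_m t^(m+1) F_(m+1)(t) with t = 1/b; the i-th Taylor coefficient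
  -- contributes to b^(-k) when m + 1 + i = k.
  refine ⟨fun k => ∑ m ∈ Finset.range k, c m * e (m + 1) (k - 1 - m), fun M => ?_⟩
  have hone : (fun b : ℕ => (1 / (b : ℝ)) ^ (M + 1)) = fun b : ℕ => 1 / (b : ℝ) ^ (M + 1) := by
    funext b; rw [div_pow, one_pow]
  have h1 : (fun b : ℕ => ifsMean b ε (fun y => harmonicExt (σ * y / b)) / b -
      ∑ m ∈ Finset.range M, c m * ifsMoment b ε (m + 1) / (b : ℝ) ^ (m + 2)) =O[atTop]
      fun b : ℕ => 1 / (b : ℝ) ^ (M + 1) := by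
    refine IsBigO.of_bound 4 ?_
    filter_upwards [eventually_ge_atTop 2] with b hb
    rw [Real.norm_eq_abs, Real.norm_eq_abs, abs_of_nonneg (a := 1 / (b : ℝ) ^ (M + 1))
      (by positivity)]
    exact abs_ifsMean_harmonicExt_sub_le hb hε hσ M
  -- The factor t^(m+1) is already present, so expanding the moment to order M - m leaves an error
  -- O(b^(-M-1)).
  have h2 : (fun b : ℕ => ∑ m ∈ Finset.range M, c m * (1 / (b : ℝ)) ^ (m + 1) *
      (F (m + 1) (1 / b) - ∑ i ∈ Finset.range (M - m), e (m + 1) i * (1 / (b : ℝ)) ^ i)) =O[atTop]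
      fun b : ℕ => 1 / (b : ℝ) ^ (M + 1) := by
    refine IsBigO.fun_sum fun m hm => ?_
    have hm' := Finset.mem_range.mp hm
    have h3 := ((isBigO_refl (fun b : ℕ => (1 / (b : ℝ)) ^ (m + 1)) atTop).const_mul_left
      (c m)).mul (he (m + 1) (M - m))
    rw [← hone]
    refine h3.congr_right fun b => ?_
    rw [← pow_add]
    congr 1
    omega
  refine (h1.add h2).congr' ?_ EventuallyEq.rfl
  filter_upwards [eventually_ge_atTop 2] with b hb
  have hb0 : (b : ℝ) ≠ 0 := by positivity
  have h4 : ∑ k ∈ Finset.Icc 1 M, (∑ m ∈ Finset.range k, c m * e (m + 1) (k - 1 - m)) / (b : ℝ) ^ k =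
      ∑ m ∈ Finset.range M, ∑ i ∈ Finset.range (M - m),
        c m * (1 / (b : ℝ)) ^ (m + 1) * (e (m + 1) i * (1 / (b : ℝ)) ^ i) := by
    rw [sum_triangle, sum_Icc_one_eq_sum_range]
    refine Finset.sum_congr rfl fun k _ => ?_
    rw [Finset.sum_div]
    refine Finset.sum_congr rfl fun m hm => ?_
    have hm' : m ≤ k := Nat.lt_succ_iff.mp (Finset.mem_range.mp hm)
    have e1 : (b : ℝ) ^ (k + 1) = (b : ℝ) ^ (m + 1) * (b : ℝ) ^ (k - m) := by
      rw [← pow_add]; congr 1; omega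
    rw [e1, Nat.add_sub_cancel, div_pow, div_pow, one_pow, one_pow]
    field_simp
  have h5 : ∑ m ∈ Finset.range M, c m * ifsMoment b ε (m + 1) / (b : ℝ) ^ (m + 2) =
      ∑ m ∈ Finset.range M, c m * (1 / (b : ℝ)) ^ (m + 1) * F (m + 1) (1 / b) := by
    refine Finset.sum_congr rfl fun m _ => ?_
    rw [← hFb (m + 1) b hb, div_pow, one_pow, pow_succ (b : ℝ) (m + 1)]
    field_simp
  rw [h4, h5]
  simp_rw [mul_sub, Finset.mul_sum]
  rw [Finset.sum_sub_distrib]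
  ring

/-! ### Two-term asymptotics. -/

lemma kempner_zero_two_terms :
    (fun b : ℕ => kempnerSum b {0} -
        ((b : ℝ) * Real.log b + zetaValue 2 / (2 * b) - zetaValue 3 / (3 * (b : ℝ) ^ 2)))
      =O[atTop] fun b : ℕ => 1 / (b : ℝ) ^ 3 := by
  -- 8 = 4 + 2 + 2: the tail after two terms, then ζ(2) and ζ(3), each at most 2, times moment
  -- errors of at most b^(-3).
  refine IsBigO.of_bound 8 ?_
  filter_upwards [eventually_ge_atTop 2] with b hb
  have hb0 : (0 : ℝ) < b := by positivity
  have hb2 : (2 : ℝ) ≤ b := by exact_mod_cast hb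
  have hT := abs_ifsMean_harmonicExt_sub_le hb (ε := 0) (σ := 1) (by simp) (by simp) 2
  rw [Real.norm_eq_abs, Real.norm_eq_abs, abs_of_nonneg (a := 1 / (b : ℝ) ^ 3) (by positivity),
    kempnerSum, (kempner_zero_hasSum hb).tsum_eq]
  generalize ifsMean b 0 (fun y => harmonicExt (1 * y / b)) / b = T at hT ⊢
  simp only [Finset.sum_range_succ, Finset.sum_range_zero, zero_add, pow_zero, one_pow, pow_one,
    one_mul, Nat.reduceAdd, mul_div_assoc, ifsMoment_zero_one_div hb,
    ifsMoment_zero_two_div hb] at hT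
  have hA := sq_sub_add_one_pos hb2
  have hB := cube_sub_add_one_pos hb2
  have hA' : (b : ℝ) ^ 2 / 2 ≤ b ^ 2 - b + 1 := by nlinarith [sq_nonneg ((b : ℝ) - 2)]
  have hB' : (b : ℝ) ^ 3 / 2 ≤ b ^ 3 - b + 1 := by
    nlinarith [mul_nonneg (sub_nonneg.mpr hb2) (sq_nonneg (b : ℝ))]
  have p1 : 0 ≤ 1 / (2 * b * ((b : ℝ) ^ 2 - b + 1)) := by positivity
  have q1 : 1 / (2 * b * ((b : ℝ) ^ 2 - b + 1)) ≤ 1 / (b : ℝ) ^ 3 :=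
    one_div_le_one_div_of_le (by positivity) (by nlinarith)
  have p2 : 0 ≤ (5 * (b : ℝ) ^ 2 - 5 * b + 2)
      / (6 * (b : ℝ) ^ 2 * ((b : ℝ) ^ 2 - b + 1) * ((b : ℝ) ^ 3 - b + 1)) :=
    div_nonneg (by nlinarith) (by positivity)
  have q2 : (5 * (b : ℝ) ^ 2 - 5 * b + 2)
      / (6 * (b : ℝ) ^ 2 * ((b : ℝ) ^ 2 - b + 1) * ((b : ℝ) ^ 3 - b + 1)) ≤ 1 / (b : ℝ) ^ 3 := by
    rw [div_le_div_iff₀ (by positivity) (by positivity), mul_assoc (6 * (b : ℝ) ^ 2), one_mul]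
    refine mul_le_mul (by nlinarith) ?_ (by positivity) (by positivity)
    nlinarith [mul_le_mul (show (2 : ℝ) ≤ b ^ 2 - b + 1 by nlinarith) hB' (by positivity) hA.le]
  have z2 := zetaValue_le_two (le_refl 2)
  have z3 := zetaValue_le_two (show 2 ≤ 3 by omega)
  have z2' := zetaValue_pos (le_refl 2)
  have z3' := zetaValue_pos (show 2 ≤ 3 by omega)
  generalize 1 / (2 * b * ((b : ℝ) ^ 2 - b + 1)) = P at *
  generalize (5 * (b : ℝ) ^ 2 - 5 * b + 2)
      / (6 * (b : ℝ) ^ 2 * ((b : ℝ) ^ 2 - b + 1) * ((b : ℝ) ^ 3 - b + 1)) = Q at *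
  have e1 : zetaValue 2 / (2 * b) = zetaValue 2 * (1 / (2 * b)) := by ring
  have e2 : zetaValue 3 / (3 * (b : ℝ) ^ 2) = zetaValue 3 * (1 / (3 * (b : ℝ) ^ 2)) := by ring
  rw [e1, e2]
  have r1 := mul_le_mul z2 q1 p1 two_pos.le
  have r2 := mul_le_mul z3 q2 p2 two_pos.le
  have s1 := mul_nonneg z2'.le p1
  have s2 := mul_nonneg z3'.le p2
  rw [abs_le] at hT ⊢
  constructor <;> linarith [hT.1, hT.2]

lemma kempner_pred_two_terms :
    (fun b : ℕ => kempnerSum b {b - 1} -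
        ((b : ℝ) * Real.log b - zetaValue 2 / (2 * b)
          - (3 * zetaValue 2 + zetaValue 3) / (3 * (b : ℝ) ^ 2)))
      =O[atTop] fun b : ℕ => 1 / (b : ℝ) ^ 3 := by
  -- 14 = 4 + 2 · 1 + 2 · 4: the tail, then the zeta values times the moment errors `P` ≤ b^(-3) and
  -- `Q` ≤ 4 b^(-3).
  refine IsBigO.of_bound 14 ?_
  filter_upwards [eventually_ge_atTop 2] with b hb
  have hb0 : (0 : ℝ) < b := by positivity
  have hb2 : (2 : ℝ) ≤ b := by exact_mod_cast hb
  have h01 : (1 : ℝ) ∈ Set.Icc (0 : ℝ) 1 := by simp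
  have hT := abs_ifsMean_harmonicExt_sub_le hb (ε := 1) (σ := -1) h01 (by simp) 2
  rw [Real.norm_eq_abs, Real.norm_eq_abs, abs_of_nonneg (a := 1 / (b : ℝ) ^ 3) (by positivity),
    kempnerSum, (kempner_pred_hasSum hb).tsum_eq]
  generalize ifsMean b 1 (fun y => harmonicExt (-1 * y / b)) / b = T at hT ⊢
  simp only [Finset.sum_range_succ, Finset.sum_range_zero, zero_add, pow_zero, pow_one,
    one_mul, Nat.reduceAdd, mul_div_assoc] at hT
  have hA := sq_sub_add_one_pos hb2
  have hB := cube_sub_add_one_pos hb2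
  have hA' : (b : ℝ) ^ 2 / 2 ≤ b ^ 2 - b + 1 := by nlinarith [sq_nonneg ((b : ℝ) - 2)]
  have hB' : (b : ℝ) ^ 3 / 2 ≤ b ^ 3 - b + 1 := by
    nlinarith [mul_nonneg (sub_nonneg.mpr hb2) (sq_nonneg (b : ℝ))]
  have h1 := ifsMoment_one hb h01
  have h2 := ifsMoment_two hb h01
  have w0 := ifsMoment_nonneg hb h01 1
  have w1 := ifsMoment_le hb h01 1
  -- The extra 1/b² comes from the atom at `ε = 1`; it is the source of the term 3ζ(2) in the second
  -- coefficient.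
  obtain ⟨P, hP⟩ : ∃ P, P = ifsMoment b 1 1 / (b : ℝ) ^ 2 - 1 / (2 * b) - 1 / (b : ℝ) ^ 2 :=
    ⟨_, rfl⟩
  obtain ⟨Q, hQ⟩ : ∃ Q, Q = ifsMoment b 1 2 / (b : ℝ) ^ 3 - 1 / (3 * (b : ℝ) ^ 2) := ⟨_, rfl⟩
  have hP' : P = (b - 2) / (2 * (b : ℝ) ^ 2 * (b ^ 2 - b + 1)) := by
    rw [hP, eq_div_iff (by positivity)]
    field_simp
    linarith
  have hQ' : Q = ((b : ℝ) ^ 3 / 2 + b ^ 2 / 2 - b / 3 + b * (b - 1) * ifsMoment b 1 1) /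
      ((b : ℝ) ^ 3 * (b ^ 3 - b + 1)) := by
    rw [hQ, eq_div_iff (by positivity)]
    field_simp
    linarith
  have p1 : 0 ≤ P := by
    rw [hP']; exact div_nonneg (by linarith) (by positivity)
  have q1 : P ≤ 1 / (b : ℝ) ^ 3 := by
    rw [hP', div_le_div_iff₀ (by positivity) (by positivity), one_mul]
    have := mul_le_mul_of_nonneg_left hA' (by positivity : 0 ≤ 2 * (b : ℝ) ^ 2)
    have : 0 < (b : ℝ) ^ 3 := by positivity
    nlinarith
  have hn : 0 ≤ (b : ℝ) * (b - 1) * ifsMoment b 1 1 :=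
    mul_nonneg (mul_nonneg hb0.le (by linarith)) w0
  have hn' : (b : ℝ) * (b - 1) * ifsMoment b 1 1 ≤ b * (b - 1) * b :=
    mul_le_mul_of_nonneg_left w1 (mul_nonneg hb0.le (by linarith))
  have p2 : 0 ≤ Q := by
    rw [hQ']
    refine div_nonneg ?_ (by positivity)
    have : 0 < (b : ℝ) ^ 3 := by positivity
    nlinarith
  have q2 : Q ≤ 4 * (1 / (b : ℝ) ^ 3) := by
    rw [hQ', mul_one_div, div_le_div_iff₀ (by positivity) (by positivity), mul_comm ((b : ℝ) ^ 3),
      ← mul_assoc]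
    refine mul_le_mul_of_nonneg_right ?_ (by positivity)
    nlinarith
  have z2 := zetaValue_le_two (le_refl 2)
  have z3 := zetaValue_le_two (show 2 ≤ 3 by omega)
  have z2' := zetaValue_pos (le_refl 2)
  have z3' := zetaValue_pos (show 2 ≤ 3 by omega)
  have e1 : ifsMoment b 1 1 / (b : ℝ) ^ 2 = P + 1 / (2 * b) + 1 / (b : ℝ) ^ 2 := by
    rw [hP]; ring
  have e2 : ifsMoment b 1 2 / (b : ℝ) ^ 3 = Q + 1 / (3 * (b : ℝ) ^ 2) := by rw [hQ]; ring
  have e3 : zetaValue 2 / (2 * b) = zetaValue 2 * (1 / (2 * b)) := by ring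
  have e4 : (3 * zetaValue 2 + zetaValue 3) / (3 * (b : ℝ) ^ 2) =
      zetaValue 2 * (1 / (b : ℝ) ^ 2) + zetaValue 3 * (1 / (3 * (b : ℝ) ^ 2)) := by
    field_simp
  rw [e1, e2] at hT
  rw [e3, e4]
  have r1 := mul_le_mul z2 q1 p1 two_pos.le
  have r2 := mul_le_mul z3 q2 p2 two_pos.le
  have s1 := mul_nonneg z2'.le p1
  have s2 := mul_nonneg z3'.le p2
  rw [abs_le] at hT ⊢
  constructor <;> linarith [hT.1, hT.2]

/-! ### Assembly of the theorem. -/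

theorem mainTheorem6 :
    -- the series defining the two Kempner sums converge
    (∀ b : ℕ, 2 ≤ b →
      Summable (fun m : kempnerSet b {0} => 1 / ((m : ℕ) : ℝ)) ∧
      Summable (fun m : kempnerSet b {b - 1} => 1 / ((m : ℕ) : ℝ))) ∧
    -- the first two terms
    ((fun b : ℕ => kempnerSum b {0} -
        ((b : ℝ) * Real.log b + zetaValue 2 / (2 * b) - zetaValue 3 / (3 * (b : ℝ) ^ 2)))
      =O[atTop] fun b : ℕ => 1 / (b : ℝ) ^ 3) ∧
    ((fun b : ℕ => kempnerSum b {b - 1} -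
        ((b : ℝ) * Real.log b - zetaValue 2 / (2 * b)
          - (3 * zetaValue 2 + zetaValue 3) / (3 * (b : ℝ) ^ 2)))
      =O[atTop] fun b : ℕ => 1 / (b : ℝ) ^ 3) ∧
    -- full asymptotic expansions
    (∃ a : ℕ → ℝ,
      HasFullExpansion (fun b : ℕ => kempnerSum b {0} - (b : ℝ) * Real.log b) a) ∧
    (∃ a : ℕ → ℝ,
      HasFullExpansion (fun b : ℕ => kempnerSum b {b - 1} - (b : ℝ) * Real.log b) a) ∧
    -- the alternating series for `K(b, {0})` and the explicit bounds it gives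
    (∀ b : ℕ, 2 ≤ b →
      HasSum (fun m : ℕ => (-1 : ℝ) ^ m * zetaValue (m + 2) * kempnerMoment b {0} (m + 1)
          / (b : ℝ) ^ (m + 2))
        (kempnerSum b {0} - (b : ℝ) * Real.log b) ∧
      (∀ n : ℕ,
        (b : ℝ) * Real.log b + ∑ m ∈ Finset.Icc 1 (2 * n),
            (-1 : ℝ) ^ (m - 1) * zetaValue (m + 1) * kempnerMoment b {0} m / (b : ℝ) ^ (m + 1)
          < kempnerSum b {0} ∧
        kempnerSum b {0} <
          (b : ℝ) * Real.log b + ∑ m ∈ Finset.Icc 1 (2 * n + 1),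
            (-1 : ℝ) ^ (m - 1) * zetaValue (m + 1) * kempnerMoment b {0} m
              / (b : ℝ) ^ (m + 1)) ∧
      ((b : ℝ) * Real.log b + zetaValue 2 * kempnerMoment b {0} 1 / (b : ℝ) ^ 2
            - zetaValue 3 * kempnerMoment b {0} 2 / (b : ℝ) ^ 3
          < kempnerSum b {0} ∧
        kempnerSum b {0} <
          (b : ℝ) * Real.log b + zetaValue 2 * kempnerMoment b {0} 1 / (b : ℝ) ^ 2
            - zetaValue 3 * kempnerMoment b {0} 2 / (b : ℝ) ^ 3
            + zetaValue 4 * kempnerMoment b {0} 3 / (b : ℝ) ^ 4) ∧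
      kempnerMoment b {0} 1 / (b : ℝ) ^ 2
        = 1 / (2 * b) - 1 / (2 * b * ((b : ℝ) ^ 2 - b + 1)) ∧
      kempnerMoment b {0} 2 / (b : ℝ) ^ 3
        = 1 / (3 * (b : ℝ) ^ 2)
          - (5 * (b : ℝ) ^ 2 - 5 * b + 2)
            / (6 * (b : ℝ) ^ 2 * ((b : ℝ) ^ 2 - b + 1) * ((b : ℝ) ^ 3 - b + 1)) ∧
      0 < kempnerMoment b {0} 3 ∧ kempnerMoment b {0} 3 < (b : ℝ) / 4) := by
  refine ⟨fun b hb => ⟨(kempner_zero_hasSum hb).summable, (kempner_pred_hasSum hb).summable⟩,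
    kempner_zero_two_terms, kempner_pred_two_terms, ?_, ?_, fun b hb => ?_⟩
  · obtain ⟨a, ha⟩ := hasFullExpansion_ifsMean (ε := 0) (σ := 1) (by simp) (by simp)
    refine ⟨a, fun M => (ha M).congr' ?_ EventuallyEq.rfl⟩
    filter_upwards [eventually_ge_atTop 2] with b hb
    rw [kempnerSum, (kempner_zero_hasSum hb).tsum_eq, add_sub_cancel_left]
  · obtain ⟨a, ha⟩ := hasFullExpansion_ifsMean (ε := 1) (σ := -1) (by simp) (by simp)
    refine ⟨a, fun M => (ha M).congr' ?_ EventuallyEq.rfl⟩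
    filter_upwards [eventually_ge_atTop 2] with b hb
    rw [kempnerSum, (kempner_pred_hasSum hb).tsum_eq, add_sub_cancel_left]
  have h0 : (0 : ℝ) ∈ Set.Icc (0 : ℝ) 1 := by simp
  have hK : kempnerSum b {0} - (b : ℝ) * Real.log b =
      ifsMean b 0 (fun y => harmonicExt (1 * y / b)) / b := by
    rw [kempnerSum, (kempner_zero_hasSum hb).tsum_eq, add_sub_cancel_left]
  have hS := ifsMean_harmonicExt_hasSum hb h0 (σ := 1) (by simp)
  rw [← hK] at hS
  simp only [one_pow, mul_one] at hS
  have hlim := hS.tendsto_sum_nat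
  simp only [mul_assoc, mul_div_assoc] at hlim
  have halt := alternating_partial_sums_lt
    (f := fun m => zetaValue (m + 2) * (ifsMoment b 0 (m + 1) / (b : ℝ) ^ (m + 2)))
    (by simpa only [mul_div_assoc] using strictAnti_zeta_mul_ifsMoment hb h0) hlim
  have hIcc (N : ℕ) : ∑ m ∈ Finset.Icc 1 N,
      (-1 : ℝ) ^ (m - 1) * zetaValue (m + 1) * ifsMoment b 0 m / (b : ℝ) ^ (m + 1) =
      ∑ m ∈ Finset.range N,
        (-1 : ℝ) ^ m * (zetaValue (m + 2) * (ifsMoment b 0 (m + 1) / (b : ℝ) ^ (m + 2))) := by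
    rw [sum_Icc_one_eq_sum_range]
    refine Finset.sum_congr rfl fun m _ => ?_
    rw [Nat.add_sub_cancel]
    ring
  simp only [kempnerMoment_zero_eq hb]
  refine ⟨hS, fun n => ?_, ?_, ifsMoment_zero_one_div hb, ifsMoment_zero_two_div hb,
    ifsMoment_pos hb h0 3, ifsMoment_zero_three_lt hb⟩
  · rw [hIcc, hIcc]
    have h := halt n
    constructor <;> linarith [h.1, h.2]
  -- The displayed bounds are the case n = 1: two terms below, three above.
  · have h := halt 1
    norm_num [Finset.sum_range_succ] at h
    simp only [mul_div_assoc]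
    constructor <;> linarith [h.1, h.2]
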